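/- Let $d\ge 0$ and let $P=\{p_1,\dots,p_d\}$ and $Q=\{q_1,\dots,q_d\}$ be disjoint partially ordered sets with $d$ elements each. For an antichain $A$ of $P$ (a set of pairwise incomparable elements, possibly empty) put $\rho(A)=\sum_{p_i\in A}\mathbf e_i\in\mathbb R^d$, and let $\mathcal C(P)=\operatorname{conv}\{\rho(A): A \text{ an antichain of } P\}$ be the chain polytope of $P$; define $\mathcal C(Q)$ in the same way from $q_1,\dots,q_d$. Let $\Gamma(P,Q)=\operatorname{conv}\bigl(\mathcal C(P)\cup(-\mathcal C(Q))\bigr)\subset\mathbb R^d$ be the twinned chain polytope, and let $N(\Gamma(P,Q))$ be its number of facets (faces of codimension one; the empty face, of dimension $-1$, is the only facet of a point). This number is finite, and $$N(\Gamma(P,Q))\le\begin{cases}6^{d/2} & \text{if } d \text{ is even},\\[2pt] 14\cdot 6^{(d-3)/2}\;\bigl(=\tfrac{7\sqrt6}{18}\cdot 6^{d/2}\bigr) & \text{if } d \text{ is odd}.\end{cases}$$ In particular $N(\Gamma(P,Q))\le 6^{d/2}$ for every $d$. If $d$ is even, then $N(\Gamma(P,Q))=6^{d/2}$ if and only if $P$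 and $Q$ are both order isomorphic to the ordinal sum $\mathbf I_2\oplus\cdots\oplus\mathbf I_2$ of $d/2$ copies of the two-element antichain $\mathbf I_2$ and the map $\varphi:P\to Q$, $\varphi(p_i)=q_i$, is a graph isomorphism from $G_P$ to $G_Q$. Here $G_P$ denotes the comparability graph of $P$: its vertices are the elements of $P$, and two distinct elements are adjacent if and only if they are comparable. In an ordinal sum, every element of an earlier summand lies below every element of a later one, and each summand keeps its own order. -/

import Mathlib

open scoped Pointwise

/-! ### Polytopes and facets -/

open Classical in
/-- The dimension of a convex set: the dimension of its affine hull, with `dim ∅ = -1`. -/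
noncomputable def convDim {E : Type*} [AddCommGroup E] [Module ℝ E] (S : Set E) : ℤ :=
  if S = ∅ then -1 else (Module.finrank ℝ (vectorSpan ℝ S) : ℤ)

/-- `F` is a facet of the polytope `S`: a face of `S`, cut out by a supporting hyperplane, whose
dimension is `dim S - 1`. (The empty set is a face, of dimension `-1`; hence it is a facet only of a
one-point polytope.) -/
def IsFacet {E : Type*} [AddCommGroup E] [Module ℝ E] [TopologicalSpace E] (S F : Set E) : Prop :=
  IsExposed ℝ S F ∧ convDim F = convDim S - 1

/-- The set of all facets of `S`. -/
def facetSet {E : Type*} [AddCommGroup E] [Module ℝ E] [TopologicalSpace E] (S : Set E) :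
    Set (Set E) :=
  {F | IsFacet S F}

/-- `N(S)`, the number of facets of `S`. -/
noncomputable def numFacets {E : Type*} [AddCommGroup E] [Module ℝ E] [TopologicalSpace E]
    (S : Set E) : ℕ :=
  (facetSet S).ncard

/-! ### Twinned chain polytopes -/

/-- `ρ(A) = ∑_{p_i ∈ A} e_i`, for a subset `A` of `P = {p_1, …, p_d}`. -/
noncomputable def indicatorVec {d : ℕ} {P : Type*} (p : Fin d ≃ P) (A : Set P) : Fin d → ℝ :=
  Set.indicator {i | p i ∈ A} 1

/-- The chain polytope of the poset `P = {p_1, …, p_d}`: the convex hull of the vectors `ρ(A)`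
for all antichains `A` of `P`. -/
def chainPolytope {d : ℕ} {P : Type*} [PartialOrder P] (p : Fin d ≃ P) : Set (Fin d → ℝ) :=
  convexHull ℝ {x | ∃ A : Set P, IsAntichain (· ≤ ·) A ∧ x = indicatorVec p A}

/-- `Γ(S, T) = conv(S ∪ (-T))`. -/
def twinned {E : Type*} [AddCommGroup E] [Module ℝ E] (S T : Set E) : Set E :=
  convexHull ℝ (S ∪ -T)

/-- The twinned chain polytope `Γ(P, Q) = Γ(C(P), C(Q))` of the posets `P = {p_1, …, p_d}` and
`Q = {q_1, …, q_d}`. -/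
def twinnedChainPolytope {d : ℕ} {P Q : Type*} [PartialOrder P] [PartialOrder Q]
    (p : Fin d ≃ P) (q : Fin d ≃ Q) : Set (Fin d → ℝ) :=
  twinned (chainPolytope p) (chainPolytope q)

/-! ### Posets -/

/-- The comparability graph of `P`: distinct elements are adjacent iff they are comparable. -/
def comparabilityGraph (P : Type*) [PartialOrder P] : SimpleGraph P :=
  SimpleGraph.fromRel (· ≤ ·)

/-- `I_n`, the antichain with `n` elements. -/
def AntichainPoset (n : ℕ) : Type := Fin n

instance (n : ℕ) : PartialOrder (AntichainPoset n) where
  le a b := a = b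
  le_refl _ := rfl
  le_trans _ _ _ h₁ h₂ := Eq.trans h₁ h₂
  le_antisymm _ _ h _ := h

/-- The ordinal sum `I_2 ⊕ ⋯ ⊕ I_2` with `k` summands: an element of an earlier summand lies below
every element of a later one, and each summand keeps its own order. -/
abbrev ordinalSumI2 (k : ℕ) : Type := Σₗ _ : Fin k, AntichainPoset 2

/-! Let G and H be the comparability graphs of P and Q, both placed on the index set. A nonnegative
vector lies in μ·C(P) as soon as all its chain sums are at most μ (`exists_smul_mem_chainPolytope`).
Splitting x into positive and negative parts therefore describes the twinned polytope by the
inequalities x(K) - x(L) ≤ 1, with K a G-clique and L an H-clique disjoint from K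
(`mem_twinnedChainPolytope_iff`). Such an inequality is tight on a facet exactly when no index
outside K ∪ L can be added both to K and to L. If i could be added to both, then x_i = 0 on the
whole face. Otherwise the vectors e_k, -e_l, e_i + e_k and -(e_i + e_l) on the face span the space.
So facets correspond to `cliquePairs` (`numFacets_twinnedChainPolytope`).

What remains is a counting problem for two arbitrary graphs G, H on one vertex set. Fixing the
status of some vertices leaves a problem of the same kind in which K and L live in different sets U
and W. The induction therefore bounds the count by `pairWeight`: a vertex of U ∩ W costs about √6,
and a vertex in only one of the sets costs 2. When U = W = V, branch on a vertex v: v ∈ K, v ∈ L, or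
neither. If v ∈ K, its G-non-neighbours leave K. If v is in neither, one of its non-neighbours is in
K or L. Call (a, b) the type of v when it has a non-neighbours in G and b in H. Most types give the
bound directly. The type (0, b) needs v to have the fewest H-non-neighbours among its
H-non-neighbours, and (1, 2) with an odd number of vertices needs a finer analysis.

For an even number of vertices every type except (1, 1) gives a strict inequality. Type (1, 1) does
too unless the two non-neighbours coincide. Equality thus makes both non-adjacency graphs one and
the same perfect matching. For a poset this means an ordinal sum of two-element antichains.
Conversely, each antichain then independently admits six states. -/

open Finset

/-! ### Clique pairs and their restriction to smaller vertex sets -/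

/-- The non-neighbours of `v` inside `V`. -/
noncomputable def nonNbrs {α : Type*} (G : SimpleGraph α) (V : Finset α) (v : α) : Finset α :=
  open Classical in V.filter fun u => u ≠ v ∧ ¬ G.Adj v u

/-- Disjoint pairs of a `G`-clique in `U` and an `H`-clique in `W` such that no vertex of `U ∩ W`
extends both. -/
noncomputable def cliquePairs {α : Type*} (G H : SimpleGraph α) (U W : Finset α) :
    Finset (Finset α × Finset α) :=
  open Classical in
  (U.powerset ×ˢ W.powerset).filter fun z =>
    (∀ i ∈ z.1, ∀ j ∈ z.1, i ≠ j → G.Adj i j) ∧ (∀ i ∈ z.2, ∀ j ∈ z.2, i ≠ j → H.Adj i j) ∧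
      (∀ i ∈ z.1, i ∉ z.2) ∧
      ∀ i ∈ U, i ∈ W → i ∉ z.1 → i ∉ z.2 → (∃ k ∈ z.1, ¬ G.Adj i k) ∨ ∃ l ∈ z.2, ¬ H.Adj i l

theorem mem_nonNbrs {α : Type*} {G : SimpleGraph α} {V : Finset α} {v u : α} :
    u ∈ nonNbrs G V v ↔ u ∈ V ∧ u ≠ v ∧ ¬ G.Adj v u := by
  classical
  simp [nonNbrs]

theorem mem_nonNbrs_comm {α : Type*} {G : SimpleGraph α} {V : Finset α} {v u : α} (hv : v ∈ V)
    (hu : u ∈ nonNbrs G V v) : v ∈ nonNbrs G V u := by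
  rw [mem_nonNbrs] at *
  exact ⟨hv, hu.2.1.symm, fun h => hu.2.2 h.symm⟩

theorem card_nonNbrs_pos {α : Type*} {G : SimpleGraph α} {V : Finset α} {v y : α} (hv : v ∈ V)
    (hy : y ∈ nonNbrs G V v) : 0 < #(nonNbrs G V y) :=
  card_pos.2 ⟨v, mem_nonNbrs_comm hv hy⟩

theorem mem_cliquePairs {α : Type*} {G H : SimpleGraph α} {U W : Finset α}
    {z : Finset α × Finset α} :
    z ∈ cliquePairs G H U W ↔ z.1 ⊆ U ∧ z.2 ⊆ W ∧
      (∀ i ∈ z.1, ∀ j ∈ z.1, i ≠ j → G.Adj i j) ∧ (∀ i ∈ z.2, ∀ j ∈ z.2, i ≠ j → H.Adj i j) ∧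
      (∀ i ∈ z.1, i ∉ z.2) ∧
      ∀ i ∈ U, i ∈ W → i ∉ z.1 → i ∉ z.2 → (∃ k ∈ z.1, ¬ G.Adj i k) ∨ ∃ l ∈ z.2, ¬ H.Adj i l := by
  classical
  simp [cliquePairs, and_assoc]

theorem card_cliquePairs_comm {α : Type*} (G H : SimpleGraph α) (U W : Finset α) :
    #(cliquePairs G H U W) = #(cliquePairs H G W U) := by
  classical
  refine Finset.card_bij' (fun z _ => z.swap) (fun z _ => z.swap) ?_ ?_ ?_ ?_
  · intro z hz
    rw [mem_cliquePairs] at *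
    obtain ⟨h1, h2, h3, h4, h5, h6⟩ := hz
    exact ⟨h2, h1, h4, h3, fun i hi hj => h5 i hj hi, fun i a b c d => (h6 i b a d c).symm⟩
  · intro z hz
    rw [mem_cliquePairs] at *
    obtain ⟨h1, h2, h3, h4, h5, h6⟩ := hz
    exact ⟨h2, h1, h4, h3, fun i hi hj => h5 i hj hi, fun i a b c d => (h6 i b a d c).symm⟩
  · simp
  · simp

/-- Fixing the traces `z.1 ∩ X = I` and `z.2 ∩ Y = J` leads to pairs on smaller vertex sets. -/
theorem card_le_card_cliquePairs {α : Type*} [DecidableEq α] {G H : SimpleGraph α}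
    {U W : Finset α} (P : Finset (Finset α × Finset α)) (hP : P ⊆ cliquePairs G H U W)
    (X Y I J : Finset α)
    (hX : ∀ z ∈ P, ∀ x ∈ X, x ∈ z.1 ↔ x ∈ I) (hY : ∀ z ∈ P, ∀ x ∈ Y, x ∈ z.2 ↔ x ∈ J)
    (hI : I ⊆ X) (hJ : J ⊆ Y) :
    ∃ U' ⊆ U \ X, ∃ W' ⊆ W \ Y, #P ≤ #(cliquePairs G H U' W') := by
  classical
  -- Keeping only common neighbours of I (resp. J) makes the last condition in `cliquePairs`
  -- survive: a remaining vertex is adjacent to all of I and J, so whatever blocks it lies outside X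
  -- (resp. Y).
  refine ⟨(U \ X).filter fun u => ∀ i ∈ I, G.Adj i u, filter_subset _ _,
    (W \ Y).filter fun u => ∀ i ∈ J, H.Adj i u, filter_subset _ _, ?_⟩
  refine Finset.card_le_card_of_injOn (fun z => (z.1 \ X, z.2 \ Y)) ?_ ?_
  · intro z hz
    have hX' := hX z hz
    have hY' := hY z hz
    have hz := hP hz
    rw [mem_coe, mem_cliquePairs] at *
    obtain ⟨h1, h2, h3, h4, h5, h6⟩ := hz
    have hIz : ∀ i ∈ I, i ∈ z.1 := fun i hi => (hX' i (hI hi)).2 hi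
    have hJz : ∀ i ∈ J, i ∈ z.2 := fun i hi => (hY' i (hJ hi)).2 hi
    refine ⟨?_, ?_, ?_, ?_, ?_, ?_⟩
    · intro x hx
      simp only [mem_sdiff, mem_filter] at hx ⊢
      exact ⟨⟨h1 hx.1, hx.2⟩, fun i hi => h3 i (hIz i hi) x hx.1 (by
        rintro rfl; exact hx.2 (hI hi))⟩
    · intro x hx
      simp only [mem_sdiff, mem_filter] at hx ⊢
      exact ⟨⟨h2 hx.1, hx.2⟩, fun i hi => h4 i (hJz i hi) x hx.1 (by
        rintro rfl; exact hx.2 (hJ hi))⟩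
    · intro i hi j hj
      simp only [mem_sdiff] at hi hj
      exact h3 i hi.1 j hj.1
    · intro i hi j hj
      simp only [mem_sdiff] at hi hj
      exact h4 i hi.1 j hj.1
    · intro i hi hj
      simp only [mem_sdiff] at hi hj
      exact h5 i hi.1 hj.1
    · intro i hi hi' hiK hiL
      simp only [mem_sdiff, mem_filter, not_and, not_not] at hi hi' hiK hiL
      rcases h6 i hi.1.1 hi'.1.1 (fun h => hi.1.2 (hiK h)) (fun h => hi'.1.2 (hiL h)) with
        ⟨k, hk, hk'⟩ | ⟨k, hk, hk'⟩
      · refine Or.inl ⟨k, ?_, hk'⟩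
        simp only [mem_sdiff]
        exact ⟨hk, fun hkX => hk' (hi.2 k ((hX' k hkX).1 hk)).symm⟩
      · refine Or.inr ⟨k, ?_, hk'⟩
        simp only [mem_sdiff]
        exact ⟨hk, fun hkX => hk' (hi'.2 k ((hY' k hkX).1 hk)).symm⟩
  · intro z hz w hw h
    simp only [Prod.mk.injEq] at h
    refine Prod.ext ?_ ?_
    · ext x
      by_cases hx : x ∈ X
      · rw [hX z hz x hx, hX w hw x hx]
      · simpa [hx] using Finset.ext_iff.1 h.1 x
    · ext x
      by_cases hx : x ∈ Y
      · rw [hY z hz x hx, hY w hw x hx]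
      · simpa [hx] using Finset.ext_iff.1 h.2 x

/-! ### The numerical bound and the weight of a pair of vertex sets -/

/-- The bound `6^(n/2)` for even `n` and `14 * 6^((n-3)/2)` for odd `n`. -/
noncomputable def pairBound : ℕ → ℝ
  | 0 => 1
  -- The value that makes `pairBound 3 = 14 = pairBound 2 + 8 * pairBound 0`, so that branching on a
  -- vertex of type (2, 2) is exactly absorbed when the number of vertices is odd.
  | 1 => 7 / 3
  | n + 2 => 6 * pairBound n

theorem pairBound_pos : ∀ n, 0 < pairBound n
  | 0 => by norm_num [pairBound]
  | 1 => by norm_num [pairBound]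
  | n + 2 => by
    have := pairBound_pos n
    rw [pairBound]; linarith

theorem pairBound_two_mul (k : ℕ) : pairBound (2 * k) = 6 ^ k := by
  induction k with
  | zero => simp [pairBound]
  | succ k ih => rw [mul_add, mul_one, pairBound, ih]; ring

theorem pairBound_two_mul_add_one (k : ℕ) : pairBound (2 * k + 1) = 7 / 3 * 6 ^ k := by
  induction k with
  | zero => simp [pairBound]
  | succ k ih => rw [show 2 * (k + 1) + 1 = 2 * k + 1 + 2 by ring, pairBound, ih]; ring

theorem pairBound_add_two (n : ℕ) : pairBound (n + 2) = 6 * pairBound n := rfl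

theorem pairBound_succ_of_even {n : ℕ} (h : Even n) :
    pairBound (n + 1) = 7 / 3 * pairBound n := by
  obtain ⟨k, rfl⟩ := h
  rw [← two_mul, pairBound_two_mul_add_one, pairBound_two_mul]

theorem pairBound_succ_of_odd {n : ℕ} (h : Odd n) :
    pairBound (n + 1) = 18 / 7 * pairBound n := by
  obtain ⟨k, rfl⟩ := h
  rw [pairBound_two_mul_add_one, show 2 * k + 1 + 1 = 2 * (k + 1) by ring, pairBound_two_mul]
  ring

theorem two_mul_pairBound_le (n : ℕ) : 2 * pairBound n ≤ pairBound (n + 1) := by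
  have := pairBound_pos n
  rcases Nat.even_or_odd n with h | h
  · rw [pairBound_succ_of_even h]; linarith
  · rw [pairBound_succ_of_odd h]; linarith

theorem two_pow_mul_pairBound_le (n k : ℕ) : 2 ^ k * pairBound n ≤ pairBound (n + k) := by
  induction k with
  | zero => simp
  | succ k ih =>
    have := two_mul_pairBound_le (n + k)
    rw [← add_assoc, pow_succ]; linarith

/-- The weight bounding the number of clique pairs on `U` and `W`. -/
noncomputable def pairWeight {α : Type*} [DecidableEq α] (U W : Finset α) : ℝ :=
  pairBound #(U ∩ W) * 2 ^ (#(U ∪ W) - #(U ∩ W))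

theorem pairWeight_comm {α : Type*} [DecidableEq α] (U W : Finset α) :
    pairWeight U W = pairWeight W U := by
  rw [pairWeight, pairWeight, inter_comm, union_comm]

/-- A vertex leaving U ∩ W may turn into one lying in a single set and gain a factor 2, but it then
lowers the argument of `pairBound`, which loses at least a factor 2 by `two_mul_pairBound_le`. -/
theorem pairWeight_mono {α : Type*} [DecidableEq α] {U W U' W' : Finset α} (hU : U' ⊆ U)
    (hW : W' ⊆ W) : pairWeight U' W' ≤ pairWeight U W := by
  have h1 : #(U' ∩ W') ≤ #(U ∩ W) := card_le_card (inter_subset_inter hU hW)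
  have h2 : #(U' ∪ W') ≤ #(U ∪ W) := card_le_card (union_subset_union hU hW)
  have h3 : #(U' ∩ W') ≤ #(U' ∪ W') := card_le_card inter_subset_union
  have h4 : #(U ∩ W) ≤ #(U ∪ W) := card_le_card inter_subset_union
  unfold pairWeight
  generalize #(U' ∩ W') = a' at *
  generalize #(U ∩ W) = a at *
  generalize #(U' ∪ W') = t' at *
  generalize #(U ∪ W) = t at *
  obtain ⟨k, rfl⟩ := Nat.exists_eq_add_of_le h1
  have := two_pow_mul_pairBound_le a' k
  calc pairBound a' * 2 ^ (t' - a') ≤ pairBound a' * 2 ^ (k + (t - (a' + k))) := by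
        have := (pairBound_pos a').le
        gcongr
        · norm_num
        · omega
    _ = 2 ^ k * pairBound a' * 2 ^ (t - (a' + k)) := by rw [pow_add]; ring
    _ ≤ _ := by gcongr

theorem pairWeight_sdiff {α : Type*} [DecidableEq α] {V X Y : Finset α} (hX : X ⊆ V)
    (hY : Y ⊆ V) : pairWeight (V \ X) (V \ Y) =
      pairBound (#V - #(X ∪ Y)) * 2 ^ (#(X ∪ Y) - #(X ∩ Y)) := by
  have h1 : (V \ X) ∩ (V \ Y) = V \ (X ∪ Y) := by ext; simp; tauto
  have h2 : (V \ X) ∪ (V \ Y) = V \ (X ∩ Y) := by ext; simp; tauto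
  have h3 := card_le_card (union_subset hX hY)
  have h4 : #(X ∩ Y) ≤ #(X ∪ Y) := card_le_card inter_subset_union
  rw [pairWeight, h1, h2, card_sdiff_of_subset (union_subset hX hY),
    card_sdiff_of_subset (inter_subset_left.trans hX)]
  congr 2
  omega

/-! ### The inductive hypothesis -/

/-- Every nontrivial restriction of the clique pairs on `V` obeys the weight bound. -/
def BranchBound {α : Type*} [DecidableEq α] (G H : SimpleGraph α) (V : Finset α) : Prop :=
  ∀ U ⊆ V, ∀ W ⊆ V, (U ≠ V ∨ W ≠ V) → (#(cliquePairs G H U W) : ℝ) ≤ pairWeight U W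

theorem BranchBound.symm {α : Type*} [DecidableEq α] {G H : SimpleGraph α} {V : Finset α}
    (h : BranchBound G H V) : BranchBound H G V := by
  intro U hU W hW hUW
  rw [card_cliquePairs_comm, pairWeight_comm]
  exact h W hW U hU hUW.symm

/-- The form used in every branch: X and Y are the vertices whose membership in K, resp. L, is
decided. Here j vertices are decided at least once and k twice; each of the j - k half-decided
vertices costs a factor 2. -/
theorem BranchBound.card_filter_le {α : Type*} [DecidableEq α] {G H : SimpleGraph α}
    {V : Finset α} (h : BranchBound G H V) (p : Finset α × Finset α → Prop) [DecidablePred p]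
    (X Y I J : Finset α) (hXV : X ⊆ V) (hYV : Y ⊆ V) (hI : I ⊆ X) (hJ : J ⊆ Y)
    (hX : ∀ z ∈ cliquePairs G H V V, p z → ∀ x ∈ X, x ∈ z.1 ↔ x ∈ I)
    (hY : ∀ z ∈ cliquePairs G H V V, p z → ∀ x ∈ Y, x ∈ z.2 ↔ x ∈ J)
    {j k : ℕ} (hj : #(X ∪ Y) = j) (hk : #(X ∩ Y) = k) (hj0 : j ≠ 0) :
    (#((cliquePairs G H V V).filter p) : ℝ) ≤ pairBound (#V - j) * 2 ^ (j - k) := by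
  obtain ⟨U', hU', W', hW', hle⟩ := card_le_card_cliquePairs (G := G) (H := H) (U := V) (W := V)
    ((cliquePairs G H V V).filter p) (filter_subset _ _) X Y I J
    (fun z hz => hX z (mem_filter.1 hz).1 (mem_filter.1 hz).2)
    (fun z hz => hY z (mem_filter.1 hz).1 (mem_filter.1 hz).2) hI hJ
  have hne : (X ∪ Y).Nonempty := by
    rw [← card_pos]; omega
  refine (Nat.cast_le.2 hle).trans ((h U' (hU'.trans sdiff_subset) W' (hW'.trans sdiff_subset)
    ?_).trans ((pairWeight_mono hU' hW').trans_eq ?_))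
  · obtain ⟨x, hx⟩ := hne
    rcases mem_union.1 hx with hx | hx
    · left
      rintro rfl
      exact (mem_sdiff.1 (hU' (hXV hx))).2 hx
    · right
      rintro rfl
      exact (mem_sdiff.1 (hW' (hYV hx))).2 hx
  · rw [pairWeight_sdiff hXV hYV, hj, hk]

theorem pairBound_sub_two {n : ℕ} (h : 2 ≤ n) : pairBound (n - 2) = pairBound n / 6 := by
  obtain ⟨k, rfl⟩ := Nat.exists_eq_add_of_le' h
  rw [Nat.add_sub_cancel, pairBound_add_two]; ring

theorem pairBound_sub_one_of_even {n : ℕ} (h : Even n) (h0 : 1 ≤ n) :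
    pairBound (n - 1) = 7 / 18 * pairBound n := by
  obtain ⟨k, rfl⟩ := Nat.exists_eq_add_of_le' h0
  rw [Nat.add_sub_cancel, pairBound_succ_of_odd (by rcases h with ⟨m, hm⟩; exact ⟨m - 1, by omega⟩)]
  ring

theorem pairBound_sub_one_of_odd {n : ℕ} (h : Odd n) :
    pairBound (n - 1) = 3 / 7 * pairBound n := by
  obtain ⟨k, rfl⟩ := h
  rw [Nat.add_sub_cancel, pairBound_succ_of_even (even_two_mul k)]
  ring

theorem pairBound_sub_three_of_even {n : ℕ} (h : Even n) (h0 : 3 ≤ n) :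
    pairBound (n - 3) = 7 / 108 * pairBound n := by
  rw [show n - 3 = n - 1 - 2 by omega, pairBound_sub_two (by omega),
    pairBound_sub_one_of_even h (by omega)]
  ring

theorem pairBound_sub_three_of_odd {n : ℕ} (h : Odd n) (h0 : 3 ≤ n) :
    pairBound (n - 3) = 1 / 14 * pairBound n := by
  rw [show n - 3 = n - 1 - 2 by omega, pairBound_sub_two (by omega),
    pairBound_sub_one_of_odd h]
  ring

theorem pairBound_sub_four {n : ℕ} (h0 : 4 ≤ n) :
    pairBound (n - 4) = 1 / 36 * pairBound n := by
  rw [show n - 4 = n - 2 - 2 by omega, pairBound_sub_two (by omega),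
    pairBound_sub_two (by omega)]
  ring

theorem Finset.card_filter_le_add {β : Type*} (Z : Finset β) (p q r : β → Prop) [DecidablePred p]
    [DecidablePred q] [DecidablePred r] (h : ∀ z ∈ Z, p z → q z ∨ r z) :
    (#(Z.filter p) : ℝ) ≤ #(Z.filter q) + #(Z.filter r) := by
  classical
  rw [← Nat.cast_add, Nat.cast_le]
  refine (card_le_card ?_).trans (card_union_le _ _)
  intro z hz
  simp only [mem_filter, mem_union] at *
  rcases h z hz.1 hz.2 with h | h
  · exact Or.inl ⟨hz.1, h⟩
  · exact Or.inr ⟨hz.1, h⟩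

/-! ### Branching on one vertex -/

section
variable {α : Type*} {G H : SimpleGraph α} {V : Finset α}

theorem card_filter_cliquePairs_comm (p q : Finset α × Finset α → Prop) [DecidablePred p]
    [DecidablePred q] (h : ∀ z, p z ↔ q z.swap) :
    #((cliquePairs G H V V).filter p) = #((cliquePairs H G V V).filter q) := by
  refine Finset.card_bij' (fun z _ => z.swap) (fun z _ => z.swap) ?_ ?_ ?_ ?_
  · intro z hz
    rw [mem_filter, mem_cliquePairs] at *
    obtain ⟨⟨h1, h2, h3, h4, h5, h6⟩, h7⟩ := hz
    exact ⟨⟨h2, h1, h4, h3, fun i hi hj => h5 i hj hi, fun i a b c d => (h6 i b a d c).symm⟩,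
      (h z).1 h7⟩
  · intro z hz
    rw [mem_filter, mem_cliquePairs] at *
    obtain ⟨⟨h1, h2, h3, h4, h5, h6⟩, h7⟩ := hz
    exact ⟨⟨h2, h1, h4, h3, fun i hi hj => h5 i hj hi, fun i a b c d => (h6 i b a d c).symm⟩,
      (h z.swap).2 (by simpa using h7)⟩
  · simp
  · simp

theorem card_cliquePairs_le_split [DecidableEq α] (G H : SimpleGraph α) (V : Finset α) (v : α) :
    (#(cliquePairs G H V V) : ℝ) ≤ #((cliquePairs G H V V).filter fun z => v ∈ z.1) +
      #((cliquePairs G H V V).filter fun z => v ∈ z.2) +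
      #((cliquePairs G H V V).filter fun z => v ∉ z.1 ∧ v ∉ z.2) := by
  have h1 := (cliquePairs G H V V).card_filter_le_add (fun _ => True) (fun z => v ∈ z.1)
    (fun z => v ∉ z.1) (fun z _ _ => em _)
  have h2 := (cliquePairs G H V V).card_filter_le_add (fun z => v ∉ z.1) (fun z => v ∈ z.2)
    (fun z => v ∉ z.1 ∧ v ∉ z.2) (fun z _ h => by tauto)
  rw [filter_true] at h1
  linarith

theorem left_notMem_right {z : Finset α × Finset α} (hz : z ∈ cliquePairs G H V V) {x : α}
    (hx : x ∈ z.1) : x ∉ z.2 :=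
  (mem_cliquePairs.1 hz).2.2.2.2.1 x hx

theorem notMem_left_of_nonNbrs {z : Finset α × Finset α} (hz : z ∈ cliquePairs G H V V) {x v : α}
    (hv : v ∈ z.1) (hx : x ∈ nonNbrs G V v) : x ∉ z.1 := fun h => by
  rw [mem_nonNbrs] at hx
  exact hx.2.2 ((mem_cliquePairs.1 hz).2.2.1 v hv x h hx.2.1.symm)

theorem notMem_right_of_nonNbrs {z : Finset α × Finset α} (hz : z ∈ cliquePairs G H V V) {x v : α}
    (hv : v ∈ z.2) (hx : x ∈ nonNbrs H V v) : x ∉ z.2 := fun h => by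
  rw [mem_nonNbrs] at hx
  exact hx.2.2 ((mem_cliquePairs.1 hz).2.2.2.1 v hv x h hx.2.1.symm)

theorem exists_nonNbr_of_notMem {z : Finset α × Finset α} (hz : z ∈ cliquePairs G H V V) {v : α}
    (hv : v ∈ V) (h1 : v ∉ z.1) (h2 : v ∉ z.2) :
    (∃ x ∈ nonNbrs G V v, x ∈ z.1) ∨ ∃ x ∈ nonNbrs H V v, x ∈ z.2 := by
  have hz := mem_cliquePairs.1 hz
  rcases hz.2.2.2.2.2 v hv hv h1 h2 with ⟨k, hk, hk'⟩ | ⟨k, hk, hk'⟩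
  · exact Or.inl ⟨k, mem_nonNbrs.2 ⟨hz.1 hk, by rintro rfl; exact h1 hk, hk'⟩, hk⟩
  · exact Or.inr ⟨k, mem_nonNbrs.2 ⟨hz.2.1 hk, by rintro rfl; exact h2 hk, hk'⟩, hk⟩

namespace BranchBound

variable [DecidableEq α] (h : BranchBound G H V) {v : α} (hv : v ∈ V)
include h hv

/-- With v ∈ K, v is decided for both cliques and S is excluded from K only. -/
theorem left_le {S : Finset α} (hS : S ⊆ nonNbrs G V v) :
    (#((cliquePairs G H V V).filter fun z => v ∈ z.1) : ℝ) ≤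
      pairBound (#V - (#S + 1)) * 2 ^ #S := by
  have hvS : v ∉ S := fun hvS => (mem_nonNbrs.1 (hS hvS)).2.1 rfl
  have hSV : S ⊆ V := fun x hx => (mem_nonNbrs.1 (hS hx)).1
  have := h.card_filter_le (fun z => v ∈ z.1) (insert v S) {v} {v} ∅
    (insert_subset hv hSV) (by simpa using hv) (by simp) (by simp) ?_ ?_ (j := #S + 1) (k := 1)
    (by rw [union_eq_left.2 (by simp), card_insert_of_notMem hvS])
    (by rw [inter_eq_right.2 (by simp), card_singleton]) (by simp)
  · simpa using this
  · intro z hz hvz x hx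
    rcases mem_insert.1 hx with rfl | hx
    · simpa using hvz
    · have h1 : x ≠ v := fun e => hvS (e ▸ hx)
      simpa [h1] using notMem_left_of_nonNbrs hz hvz (hS hx)
  · intro z hz hvz x hx
    rw [mem_singleton] at hx
    subst hx
    simpa using left_notMem_right hz hvz

theorem right_le {S : Finset α} (hS : S ⊆ nonNbrs H V v) :
    (#((cliquePairs G H V V).filter fun z => v ∈ z.2) : ℝ) ≤
      pairBound (#V - (#S + 1)) * 2 ^ #S := by
  rw [card_filter_cliquePairs_comm (fun z => v ∈ z.2) (fun z => v ∈ z.1) (fun z => Iff.rfl)]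
  exact h.symm.left_le hv hS

theorem neither_le :
    (#((cliquePairs G H V V).filter fun z => v ∉ z.1 ∧ v ∉ z.2) : ℝ) ≤ pairBound (#V - 1) := by
  have := h.card_filter_le (fun z => v ∉ z.1 ∧ v ∉ z.2) {v} {v} ∅ ∅
    (by simpa using hv) (by simpa using hv) (by simp) (by simp) (by simp +contextual)
    (by simp +contextual) (j := 1) (k := 1) (by simp) (by simp) (by simp)
  simpa using this

/-- As `left_le` at u, except that v ∈ S is also known to be outside L, which saves one factor 2. -/
theorem neither_left_le {u : α} {S : Finset α} (hS : S ⊆ nonNbrs G V u) (hu : u ∈ V)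
    (hvS : v ∈ S) :
    (#((cliquePairs G H V V).filter fun z => v ∉ z.1 ∧ v ∉ z.2 ∧ u ∈ z.1) : ℝ) ≤
      pairBound (#V - (#S + 1)) * 2 ^ (#S - 1) := by
  have huS : u ∉ S := fun hvS => (mem_nonNbrs.1 (hS hvS)).2.1 rfl
  have hSV : S ⊆ V := fun x hx => (mem_nonNbrs.1 (hS hx)).1
  have huv : u ≠ v := by rintro rfl; exact huS hvS
  have := h.card_filter_le (fun z => v ∉ z.1 ∧ v ∉ z.2 ∧ u ∈ z.1) (insert u S) {u, v} {u} ∅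
    (insert_subset hu hSV) (insert_subset hu (by simpa using hv)) (by simp) (by simp) ?_ ?_
    (j := #S + 1) (k := 2)
    (by rw [union_eq_left.2 (by simp [insert_subset_iff, hvS]), card_insert_of_notMem huS])
    (by rw [inter_eq_right.2 (by simp [insert_subset_iff, hvS]), card_pair huv]) (by simp)
  · simpa using this
  · rintro z hz ⟨-, -, huz⟩ x hx
    rcases mem_insert.1 hx with rfl | hx
    · simpa using huz
    · have h1 : x ≠ u := fun e => huS (e ▸ hx)
      simpa [h1] using notMem_left_of_nonNbrs hz huz (hS hx)
  · rintro z hz ⟨-, hvz, huz⟩ x hx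
    rcases mem_insert.1 hx with rfl | hx
    · simpa using left_notMem_right hz huz
    · rw [mem_singleton] at hx
      subst hx
      simpa using hvz

theorem neither_right_le {u : α} {S : Finset α} (hS : S ⊆ nonNbrs H V u) (hu : u ∈ V)
    (hvS : v ∈ S) :
    (#((cliquePairs G H V V).filter fun z => v ∉ z.1 ∧ v ∉ z.2 ∧ u ∈ z.2) : ℝ) ≤
      pairBound (#V - (#S + 1)) * 2 ^ (#S - 1) := by
  rw [card_filter_cliquePairs_comm (fun z => v ∉ z.1 ∧ v ∉ z.2 ∧ u ∈ z.2)
    (fun z => v ∉ z.1 ∧ v ∉ z.2 ∧ u ∈ z.1)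
    (fun z => by simp; tauto)]
  exact h.symm.neither_left_le hv hS hu hvS

/-- At least two non-neighbours in both graphs. -/
theorem card_le_of_two_two (hG : 2 ≤ #(nonNbrs G V v)) (hH : 2 ≤ #(nonNbrs H V v)) :
    3 ≤ #V ∧ (#(cliquePairs G H V V) : ℝ) ≤ pairBound (#V - 1) + 8 * pairBound (#V - 3) := by
  obtain ⟨S, hS, hSc⟩ := exists_subset_card_eq hG
  obtain ⟨T, hT, hTc⟩ := exists_subset_card_eq hH
  have hn : #(insert v S) ≤ #V := card_le_card
    (insert_subset hv fun x hx => (mem_nonNbrs.1 (hS hx)).1)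
  rw [card_insert_of_notMem fun hvS => (mem_nonNbrs.1 (hS hvS)).2.1 rfl] at hn
  have h1 := h.left_le hv hS
  have h2 := h.right_le hv hT
  have h3 := h.neither_le hv
  have h4 := card_cliquePairs_le_split G H V v
  rw [hSc] at h1 hn
  rw [hTc] at h2
  norm_num at h1 h2
  exact ⟨hn, by linarith⟩

/-- No non-neighbour in `G`, and every `H`-non-neighbour has at least as many
non-neighbours. -/
theorem card_le_of_zero (hG : nonNbrs G V v = ∅)
    (hmin : ∀ y ∈ nonNbrs H V v, #(nonNbrs H V v) ≤ #(nonNbrs H V y)) :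
    #(nonNbrs H V v) + 1 ≤ #V ∧
    (#(cliquePairs G H V V) : ℝ) ≤ pairBound (#V - 1) +
      (#(nonNbrs H V v) + 2) / 2 * 2 ^ #(nonNbrs H V v) *
        pairBound (#V - (#(nonNbrs H V v) + 1)) := by
  have hn : #(insert v (nonNbrs H V v)) ≤ #V := card_le_card
    (insert_subset hv fun x hx => (mem_nonNbrs.1 hx).1)
  rw [card_insert_of_notMem fun hvS => (mem_nonNbrs.1 hvS).2.1 rfl] at hn
  refine ⟨hn, ?_⟩
  have h1 := h.left_le hv (empty_subset _)
  have h2 := h.right_le hv subset_rfl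
  have h3 : (#((cliquePairs G H V V).filter fun z => v ∉ z.1 ∧ v ∉ z.2) : ℝ) ≤
      ∑ y ∈ nonNbrs H V v, (#((cliquePairs G H V V).filter
        fun z => v ∉ z.1 ∧ v ∉ z.2 ∧ y ∈ z.2) : ℝ) := by
    rw [← Nat.cast_sum, Nat.cast_le]
    refine (card_le_card ?_).trans card_biUnion_le
    intro z hz
    rw [mem_filter] at hz
    rcases exists_nonNbr_of_notMem hz.1 hv hz.2.1 hz.2.2 with ⟨x, hx, -⟩ | ⟨x, hx, hxz⟩
    · simp [hG] at hx
    · exact mem_biUnion.2 ⟨x, hx, mem_filter.2 ⟨hz.1, hz.2.1, hz.2.2, hxz⟩⟩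
  have h4 : ∀ y ∈ nonNbrs H V v, (#((cliquePairs G H V V).filter
        fun z => v ∉ z.1 ∧ v ∉ z.2 ∧ y ∈ z.2) : ℝ) ≤
      pairBound (#V - (#(nonNbrs H V v) + 1)) * 2 ^ (#(nonNbrs H V v)) / 2 := by
    intro y hy
    have hvy := mem_nonNbrs_comm hv hy
    have hpos : 1 ≤ #(nonNbrs H V v) := card_pos.2 ⟨y, hy⟩
    -- Minimality lets y exclude as many vertices from L as v does, with v itself among them.
    obtain ⟨S, hvS, hS, hSc⟩ := exists_subsuperset_card_eq (singleton_subset_iff.2 hvy)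
      (by simpa using hpos) (hmin y hy)
    have := h.neither_right_le hv hS (mem_nonNbrs.1 hy).1 (by simpa using hvS)
    rw [hSc] at this
    refine this.trans_eq ?_
    obtain ⟨m, hm⟩ := Nat.exists_eq_add_of_le' hpos
    rw [hm, Nat.add_sub_cancel, pow_succ]
    ring
  have h5 := sum_le_sum h4
  rw [sum_const, nsmul_eq_mul] at h5
  have h6 := card_cliquePairs_le_split G H V v
  simp only [card_empty, zero_add, pow_zero, mul_one] at h1
  linarith

/-- One non-neighbour in each graph. -/
theorem card_le_of_one_one {x y : α} (hG : nonNbrs G V v = {x}) (hH : nonNbrs H V v = {y})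
    {a b : ℕ} (ha0 : 1 ≤ a) (hb0 : 1 ≤ b)
    (ha : a ≤ #(nonNbrs G V x)) (hb : b ≤ #(nonNbrs H V y)) :
    2 ≤ #V ∧ (#(cliquePairs G H V V) : ℝ) ≤
      #((cliquePairs G H V V).filter fun z => v ∈ z.1) + 2 * pairBound (#V - 2) +
      pairBound (#V - (a + 1)) * 2 ^ (a - 1) + pairBound (#V - (b + 1)) * 2 ^ (b - 1) := by
  have hx : x ∈ nonNbrs G V v := by simp [hG]
  have hy : y ∈ nonNbrs H V v := by simp [hH]
  have hn : #{v, x} ≤ #V := card_le_card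
    (insert_subset hv (by simpa using (mem_nonNbrs.1 hx).1))
  rw [card_pair (mem_nonNbrs.1 hx).2.1.symm] at hn
  have h2 := h.right_le hv subset_rfl
  obtain ⟨S, hvS, hS, hSc⟩ := exists_subsuperset_card_eq
    (singleton_subset_iff.2 (mem_nonNbrs_comm hv hx)) (by simpa using ha0) ha
  obtain ⟨T, hvT, hT, hTc⟩ := exists_subsuperset_card_eq
    (singleton_subset_iff.2 (mem_nonNbrs_comm hv hy)) (by simpa using hb0) hb
  have h3 := h.neither_left_le hv hS (mem_nonNbrs.1 hx).1 (by simpa using hvS)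
  have h4 := h.neither_right_le hv hT (mem_nonNbrs.1 hy).1 (by simpa using hvT)
  have h5 := card_cliquePairs_le_split G H V v
  have h6 := (cliquePairs G H V V).card_filter_le_add (fun z => v ∉ z.1 ∧ v ∉ z.2)
    (fun z => v ∉ z.1 ∧ v ∉ z.2 ∧ x ∈ z.1) (fun z => v ∉ z.1 ∧ v ∉ z.2 ∧ y ∈ z.2) (by
      rintro z hz ⟨h1, h2⟩
      have := exists_nonNbr_of_notMem hz hv h1 h2
      simp only [hG, hH, mem_singleton, exists_eq_left] at this
      tauto)
  rw [hH, card_singleton] at h2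
  rw [hSc] at h3
  rw [hTc] at h4
  norm_num at h2
  exact ⟨hn, by linarith⟩

end BranchBound
end

/-! ### Refined estimates, and type (1, 2) for an odd number of vertices -/

namespace BranchBound
variable {α : Type*} [DecidableEq α] {G H : SimpleGraph α} {V : Finset α}

/-- A refinement of `left_le` using the `H`-non-neighbours of a `G`-non-neighbour of `v`. -/
theorem left_le_of_nonNbr (h : BranchBound G H V) {v x : α} (hv : v ∈ V)
    (hx : x ∈ nonNbrs G V v) {T : Finset α} (hT : T ⊆ nonNbrs H V x) (hvT : v ∉ T) :
    (#((cliquePairs G H V V).filter fun z => v ∈ z.1) : ℝ) ≤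
      pairBound (#V - 2) + pairBound (#V - (#T + 2)) * 2 ^ #T := by
  have hxV := (mem_nonNbrs.1 hx).1
  have hxv := (mem_nonNbrs.1 hx).2.1
  have hTV : T ⊆ V := fun x hx => (mem_nonNbrs.1 (hT hx)).1
  have hxT : x ∉ T := fun hxT => (mem_nonNbrs.1 (hT hxT)).2.1 rfl
  -- Since x ∉ K, split on x ∈ L: if so, T leaves L; if not, x is fully decided.
  have h0 := (cliquePairs G H V V).card_filter_le_add (fun z => v ∈ z.1)
    (fun z => v ∈ z.1 ∧ x ∈ z.2) (fun z => v ∈ z.1 ∧ x ∉ z.2) (by intros; tauto)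
  have h1 := h.card_filter_le (fun z => v ∈ z.1 ∧ x ∈ z.2) {v, x} (insert v (insert x T)) {v} {x}
    (by grind) (by grind) (by grind) (by grind) ?_ ?_ (j := #T + 2) (k := 2)
    (by rw [union_eq_right.2 (by grind), card_insert_of_notMem (by grind),
      card_insert_of_notMem hxT])
    (by rw [inter_eq_left.2 (by grind), card_pair hxv.symm]) (by simp)
  · have h2 := h.card_filter_le (fun z => v ∈ z.1 ∧ x ∉ z.2) {v, x} {v, x} {v} ∅
      (by grind) (by grind) (by grind) (by grind) ?_ ?_ (j := 2) (k := 2)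
      (by grind) (by rw [inter_self, card_pair hxv.symm]) (by simp)
    · rw [Nat.add_sub_cancel] at h1
      simp only [Nat.sub_self, pow_zero, mul_one] at h2
      linarith
    · rintro z hz ⟨hvz, -⟩
      have := notMem_left_of_nonNbrs hz hvz hx
      grind
    · rintro z hz ⟨hvz, hxz⟩
      have := left_notMem_right hz hvz
      grind
  · rintro z hz ⟨hvz, -⟩
    have := notMem_left_of_nonNbrs hz hvz hx
    grind
  · rintro z hz ⟨hvz, hxz⟩ u hu
    have := left_notMem_right hz hvz
    have := fun t (ht : t ∈ T) => notMem_right_of_nonNbrs hz hxz (hT ht)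
    grind

/-- Two `H`-non-neighbours of `v`, each with a further `G`-non-neighbour. -/
theorem right_le_of_nonNbrs (h : BranchBound G H V) (hodd : Odd #V) {v y₁ y₂ s₁ s₂ : α}
    (hv : v ∈ V) (hy : y₁ ≠ y₂) (hy₁ : y₁ ∈ nonNbrs H V v) (hy₂ : y₂ ∈ nonNbrs H V v)
    (hs₁ : s₁ ∈ nonNbrs G V y₁) (hs₂ : s₂ ∈ nonNbrs G V y₂) (hs₁v : s₁ ≠ v) (hs₂v : s₂ ≠ v) :
    (#((cliquePairs G H V V).filter fun z => v ∈ z.2) : ℝ) ≤ 5 / 21 * pairBound #V := by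
  have hy₁V := (mem_nonNbrs.1 hy₁).1
  have hy₁v := (mem_nonNbrs.1 hy₁).2.1
  have hy₂V := (mem_nonNbrs.1 hy₂).1
  have hy₂v := (mem_nonNbrs.1 hy₂).2.1
  have hs₁V := (mem_nonNbrs.1 hs₁).1
  have hs₂V := (mem_nonNbrs.1 hs₂).1
  have hsy₁ := (mem_nonNbrs.1 hs₁).2.1
  have hsy₂ := (mem_nonNbrs.1 hs₂).2.1
  have hpos := pairBound_pos #V
  have h0 := (cliquePairs G H V V).card_filter_le_add (fun z => v ∈ z.2)
    (fun z => v ∈ z.2 ∧ y₁ ∈ z.1) (fun z => v ∈ z.2 ∧ y₁ ∉ z.1) (by intros; tauto)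
  have h0' := (cliquePairs G H V V).card_filter_le_add (fun z => v ∈ z.2 ∧ y₁ ∉ z.1)
    (fun z => v ∈ z.2 ∧ y₁ ∉ z.1 ∧ y₂ ∈ z.1) (fun z => v ∈ z.2 ∧ y₁ ∉ z.1 ∧ y₂ ∉ z.1)
    (by intros; tauto)
  have hn3 : 3 ≤ #V := by
    have : #{v, y₁, y₂} ≤ #V := card_le_card (by grind)
    grind
  have h3 := h.card_filter_le (fun z => v ∈ z.2 ∧ y₁ ∉ z.1 ∧ y₂ ∉ z.1) {v, y₁, y₂} {v, y₁, y₂}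
    ∅ {v} (by grind) (by grind) (by grind) (by grind)
    (by rintro z hz ⟨a, b, c⟩
        have := fun hv => left_notMem_right (x := v) hz hv
        grind)
    (by rintro z hz ⟨a, b, c⟩
        have := notMem_right_of_nonNbrs hz a hy₁
        have := notMem_right_of_nonNbrs hz a hy₂
        grind)
    (j := 3) (k := 3) (by grind) (by rw [inter_self]; grind) (by simp)
  have e3 := pairBound_sub_three_of_odd hodd hn3
  -- If y₁, y₂ are non-adjacent in G, the three branches each fully decide v, y₁, y₂ and total 3/14
  -- of `pairBound #V`. Otherwise s₁ and s₂ are new vertices excluded from K, and the branches give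
  -- 1/9 + 1/18 + 1/14 = 5/21.
  by_cases hyy : y₂ ∈ nonNbrs G V y₁
  · have hyy' := mem_nonNbrs_comm hy₁V hyy
    have h1 := h.card_filter_le (fun z => v ∈ z.2 ∧ y₁ ∈ z.1) {v, y₁, y₂} {v, y₁, y₂}
      {y₁} {v} (by grind) (by grind) (by grind) (by grind)
      (by rintro z hz ⟨a, b⟩
          have := fun hv => left_notMem_right (x := v) hz hv
          have := notMem_left_of_nonNbrs hz b hyy
          grind)
      (by rintro z hz ⟨a, b⟩
          have := notMem_right_of_nonNbrs hz a hy₁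
          have := notMem_right_of_nonNbrs hz a hy₂
          grind)
      (j := 3) (k := 3) (by grind) (by rw [inter_self]; grind) (by simp)
    have h2 := h.card_filter_le (fun z => v ∈ z.2 ∧ y₁ ∉ z.1 ∧ y₂ ∈ z.1) {v, y₁, y₂} {v, y₁, y₂}
      {y₂} {v} (by grind) (by grind) (by grind) (by grind)
      (by rintro z hz ⟨a, b, c⟩
          have := fun hv => left_notMem_right (x := v) hz hv
          grind)
      (by rintro z hz ⟨a, b, c⟩
          have := notMem_right_of_nonNbrs hz a hy₁
          have := notMem_right_of_nonNbrs hz a hy₂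
          grind)
      (j := 3) (k := 3) (by grind) (by rw [inter_self]; grind) (by simp)
    rw [e3] at h1 h2 h3
    norm_num at h1 h2 h3
    linarith
  · have hs₁y : s₁ ≠ y₂ := fun e => hyy (e ▸ hs₁)
    have hs₂y : s₂ ≠ y₁ := fun e => hyy (mem_nonNbrs_comm hy₂V (e ▸ hs₂))
    have hn4 : 4 ≤ #V := by
      have : #{v, y₁, y₂, s₁} ≤ #V := card_le_card (by grind)
      grind
    have e4 := pairBound_sub_four hn4
    have h1 := h.card_filter_le (fun z => v ∈ z.2 ∧ y₁ ∈ z.1) {v, y₁, s₁} {v, y₁, y₂}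
      {y₁} {v} (by grind) (by grind) (by grind) (by grind)
      (by rintro z hz ⟨a, b⟩
          have := fun hv => left_notMem_right (x := v) hz hv
          have := notMem_left_of_nonNbrs hz b hs₁
          grind)
      (by rintro z hz ⟨a, b⟩
          have := notMem_right_of_nonNbrs hz a hy₁
          have := notMem_right_of_nonNbrs hz a hy₂
          grind)
      (j := 4) (k := 2) (by grind)
      (by rw [show ({v, y₁, s₁} : Finset α) ∩ {v, y₁, y₂} = {v, y₁} by grind]; grind) (by simp)
    have h2 := h.card_filter_le (fun z => v ∈ z.2 ∧ y₁ ∉ z.1 ∧ y₂ ∈ z.1) {v, y₁, y₂, s₂}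
      {v, y₁, y₂} {y₂} {v} (by grind) (by grind) (by grind) (by grind)
      (by rintro z hz ⟨a, b, c⟩
          have := fun hv => left_notMem_right (x := v) hz hv
          have := notMem_left_of_nonNbrs hz c hs₂
          grind)
      (by rintro z hz ⟨a, b, c⟩
          have := notMem_right_of_nonNbrs hz a hy₁
          have := notMem_right_of_nonNbrs hz a hy₂
          grind)
      (j := 4) (k := 3) (by grind)
      (by rw [show ({v, y₁, y₂, s₂} : Finset α) ∩ {v, y₁, y₂} = {v, y₁, y₂} by grind]; grind)
      (by simp)
    rw [e3] at h3
    rw [e4] at h1 h2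
    norm_num at h1 h2 h3
    linarith

/-- The common non-neighbour case for the pairs avoiding `v`. -/
theorem neither_le_of_common (h : BranchBound G H V) (hodd : Odd #V) {v x y : α}
    (hv : v ∈ V) (hxy : x ≠ y) (hG : nonNbrs G V v = {x}) (hH : nonNbrs H V v = {x, y})
    (h2 : 2 ≤ #(nonNbrs G V x) ∨ 2 ≤ #(nonNbrs H V x)) :
    (#((cliquePairs G H V V).filter fun z => v ∉ z.1 ∧ v ∉ z.2) : ℝ) ≤
      8 / 21 * pairBound #V := by
  have hxG : x ∈ nonNbrs G V v := by simp [hG]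
  have hxH : x ∈ nonNbrs H V v := by simp [hH]
  have hyH : y ∈ nonNbrs H V v := by simp [hH]
  have hxV := (mem_nonNbrs.1 hxH).1
  have hxv := (mem_nonNbrs.1 hxH).2.1
  have hyV := (mem_nonNbrs.1 hyH).1
  have hyv := (mem_nonNbrs.1 hyH).2.1
  have hpos := pairBound_pos #V
  have hvG := mem_nonNbrs_comm hv hxG
  have hvH := mem_nonNbrs_comm hv hxH
  have hn3 : 3 ≤ #V := by
    have : #{v, x, y} ≤ #V := card_le_card (by grind)
    grind
  have e2 := pairBound_sub_two (n := #V) (by omega)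
  have e3 := pairBound_sub_three_of_odd hodd hn3
  have c1 := (cliquePairs G H V V).card_filter_le_add (fun z => v ∉ z.1 ∧ v ∉ z.2)
    (fun z => v ∉ z.1 ∧ v ∉ z.2 ∧ x ∈ z.1) (fun z => v ∉ z.1 ∧ v ∉ z.2 ∧ x ∉ z.1)
    (by intros; tauto)
  have c2 := (cliquePairs G H V V).card_filter_le_add (fun z => v ∉ z.1 ∧ v ∉ z.2 ∧ x ∉ z.1)
    (fun z => v ∉ z.1 ∧ v ∉ z.2 ∧ x ∈ z.2)
    (fun z => v ∉ z.1 ∧ v ∉ z.2 ∧ x ∉ z.1 ∧ x ∉ z.2 ∧ y ∈ z.2) (by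
      rintro z hz ⟨h1, h2, h3⟩
      have := exists_nonNbr_of_notMem hz hv h1 h2
      simp only [hG, hH, mem_singleton, exists_eq_left, mem_insert, exists_eq_or_imp] at this
      tauto)
  have b3 := h.card_filter_le (fun z => v ∉ z.1 ∧ v ∉ z.2 ∧ x ∉ z.1 ∧ x ∉ z.2 ∧ y ∈ z.2)
    {v, x, y} {v, x, y} ∅ {y} (by grind) (by grind) (by grind) (by grind)
    (by rintro z hz ⟨a, b, c, d, e⟩
        have := fun hv => left_notMem_right (x := y) hz hv
        grind)
    (by rintro z hz ⟨a, b, c, d, e⟩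
        grind)
    (j := 3) (k := 3) (by grind) (by rw [inter_self]; grind) (by simp)
  have b1 : ∃ S ⊆ nonNbrs G V x, v ∈ S ∧ #S = min 2 #(nonNbrs G V x) := by
    obtain ⟨S, h1, h2, h3⟩ := exists_subsuperset_card_eq (singleton_subset_iff.2 hvG)
      (n := min 2 #(nonNbrs G V x)) (by
        have := card_pos.2 ⟨v, hvG⟩
        rw [card_singleton]; omega) (min_le_right _ _)
    exact ⟨S, h2, by simpa using h1, h3⟩
  have b2 : ∃ S ⊆ nonNbrs H V x, v ∈ S ∧ #S = min 2 #(nonNbrs H V x) := by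
    obtain ⟨S, h1, h2, h3⟩ := exists_subsuperset_card_eq (singleton_subset_iff.2 hvH)
      (n := min 2 #(nonNbrs H V x)) (by
        have := card_pos.2 ⟨v, hvH⟩
        rw [card_singleton]; omega) (min_le_right _ _)
    exact ⟨S, h2, by simpa using h1, h3⟩
  obtain ⟨S, hS, hvS, hSc⟩ := b1
  obtain ⟨T, hT, hvT, hTc⟩ := b2
  have d1 := h.neither_left_le hv hS hxV hvS
  have d2 := h.neither_right_le hv hT hxV hvT
  have := card_pos.2 ⟨v, hvG⟩
  have := card_pos.2 ⟨v, hvH⟩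
  have hS' : #S = 1 ∨ #S = 2 := by omega
  have hT' : #T = 1 ∨ #T = 2 := by omega
  have hST : #S = 2 ∨ #T = 2 := by omega
  rw [e3] at b3
  norm_num at b3
  -- The branches x ∈ K and x ∈ L cost 1/6 each, or 1/7 where x has two non-neighbours. One such
  -- saving suffices: 1/6 + 1/7 + 1/14 = 8/21.
  rcases hS' with hS' | hS' <;> rcases hT' with hT' | hT'
  · omega
  all_goals
    rw [hS'] at d1
    rw [hT'] at d2
    norm_num at d1 d2
    simp only [e2, e3] at d1 d2
    linarith

/-- Some non-neighbour of v must block it. The branches x ∈ K, then y₁ ∈ L, then y₂ ∈ L, each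
excluding the earlier ones, contribute 1/7 + 1/9 + 1/9 = 23/63. -/
theorem neither_le_of_three (h : BranchBound G H V) (hodd : Odd #V) {v x y₁ y₂ : α}
    (hv : v ∈ V) (hxy₁ : x ≠ y₁) (hxy₂ : x ≠ y₂) (hy : y₁ ≠ y₂)
    (hG : nonNbrs G V v = {x}) (hH : nonNbrs H V v = {y₁, y₂})
    (hx2 : 2 ≤ #(nonNbrs G V x)) (hy2 : 2 ≤ #(nonNbrs H V y₁)) :
    (#((cliquePairs G H V V).filter fun z => v ∉ z.1 ∧ v ∉ z.2) : ℝ) ≤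
      23 / 63 * pairBound #V := by
  have hxG : x ∈ nonNbrs G V v := by simp [hG]
  have hyH₁ : y₁ ∈ nonNbrs H V v := by simp [hH]
  have hyH₂ : y₂ ∈ nonNbrs H V v := by simp [hH]
  have hxV := (mem_nonNbrs.1 hxG).1
  have hxv := (mem_nonNbrs.1 hxG).2.1
  have hyV₁ := (mem_nonNbrs.1 hyH₁).1
  have hyv₁ := (mem_nonNbrs.1 hyH₁).2.1
  have hyV₂ := (mem_nonNbrs.1 hyH₂).1
  have hyv₂ := (mem_nonNbrs.1 hyH₂).2.1
  have hpos := pairBound_pos #V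
  have hvG := mem_nonNbrs_comm hv hxG
  have hvH₁ := mem_nonNbrs_comm hv hyH₁
  have hn4 : 4 ≤ #V := by
    have : #{v, x, y₁, y₂} ≤ #V := card_le_card (by grind)
    grind
  have e3 := pairBound_sub_three_of_odd hodd (by omega)
  have e4 := pairBound_sub_four hn4
  have c1 := (cliquePairs G H V V).card_filter_le_add (fun z => v ∉ z.1 ∧ v ∉ z.2)
    (fun z => v ∉ z.1 ∧ v ∉ z.2 ∧ x ∈ z.1) (fun z => v ∉ z.1 ∧ v ∉ z.2 ∧ x ∉ z.1)
    (by intros; tauto)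
  have c2 := (cliquePairs G H V V).card_filter_le_add (fun z => v ∉ z.1 ∧ v ∉ z.2 ∧ x ∉ z.1)
    (fun z => v ∉ z.1 ∧ v ∉ z.2 ∧ x ∉ z.1 ∧ y₁ ∈ z.2)
    (fun z => v ∉ z.1 ∧ v ∉ z.2 ∧ x ∉ z.1 ∧ y₁ ∉ z.2 ∧ y₂ ∈ z.2) (by
      rintro z hz ⟨h1, h2, h3⟩
      have := exists_nonNbr_of_notMem hz hv h1 h2
      simp only [hG, hH, mem_singleton, exists_eq_left, mem_insert, exists_eq_or_imp] at this
      tauto)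
  obtain ⟨S, hvS, hS, hSc⟩ := exists_subsuperset_card_eq (singleton_subset_iff.2 hvG)
    (n := 2) (by simp) hx2
  have d1 := h.neither_left_le hv hS hxV (by simpa using hvS)
  obtain ⟨t, ht, htv⟩ := exists_mem_ne hy2 v
  have htV := (mem_nonNbrs.1 ht).1
  have hty := (mem_nonNbrs.1 ht).2.1
  have d3 := h.card_filter_le (fun z => v ∉ z.1 ∧ v ∉ z.2 ∧ x ∉ z.1 ∧ y₁ ∉ z.2 ∧ y₂ ∈ z.2)
    {v, x, y₂} {v, y₁, y₂} ∅ {y₂} (by grind) (by grind) (by grind) (by grind)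
    (by rintro z hz ⟨a, b, c, d, e⟩
        have := fun hv => left_notMem_right (x := y₂) hz hv
        grind)
    (by rintro z hz ⟨a, b, c, d, e⟩
        grind)
    (j := 4) (k := 2) (by grind)
    (by rw [show ({v, x, y₂} : Finset α) ∩ {v, y₁, y₂} = {v, y₂} by grind]; grind) (by simp)
  have d2 : (#((cliquePairs G H V V).filter fun z => v ∉ z.1 ∧ v ∉ z.2 ∧ x ∉ z.1 ∧ y₁ ∈ z.2) : ℝ)
      ≤ 1 / 9 * pairBound #V := by
    by_cases htx : t = x
    · have := h.card_filter_le (fun z => v ∉ z.1 ∧ v ∉ z.2 ∧ x ∉ z.1 ∧ y₁ ∈ z.2)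
        {v, x, y₁} {v, x, y₁} ∅ {y₁} (by grind) (by grind) (by grind) (by grind)
        (by rintro z hz ⟨a, b, c, d⟩
            have := fun hv => left_notMem_right (x := y₁) hz hv
            grind)
        (by rintro z hz ⟨a, b, c, d⟩
            have := notMem_right_of_nonNbrs hz d ht
            grind)
        (j := 3) (k := 3) (by grind) (by rw [inter_self]; grind) (by simp)
      rw [e3] at this
      norm_num at this
      linarith
    · have := h.card_filter_le (fun z => v ∉ z.1 ∧ v ∉ z.2 ∧ x ∉ z.1 ∧ y₁ ∈ z.2)
        {v, y₁, x} {v, y₁, t} ∅ {y₁} (by grind) (by grind) (by grind) (by grind)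
        (by rintro z hz ⟨a, b, c, d⟩
            have := fun hv => left_notMem_right (x := y₁) hz hv
            grind)
        (by rintro z hz ⟨a, b, c, d⟩
            have := notMem_right_of_nonNbrs hz d ht
            grind)
        (j := 4) (k := 2) (by grind)
        (by rw [show ({v, y₁, x} : Finset α) ∩ {v, y₁, t} = {v, y₁} by grind]; grind) (by simp)
      rw [e4] at this
      norm_num at this
      linarith
  rw [hSc] at d1
  rw [e4] at d3
  norm_num at d1 d3
  rw [e3] at d1
  linarith

/-- One `G`-non-neighbour and two `H`-non-neighbours, odd number of vertices. -/
theorem card_le_of_one_two (h : BranchBound G H V) (hodd : Odd #V) {v x y₁ y₂ : α}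
    (hv : v ∈ V) (hy : y₁ ≠ y₂) (hG : nonNbrs G V v = {x}) (hH : nonNbrs H V v = {y₁, y₂})
    (hx : 2 ≤ #(nonNbrs G V x) ∨ 2 ≤ #(nonNbrs H V x))
    (hy₁ : nonNbrs G V y₁ = ∅ → 2 ≤ #(nonNbrs H V y₁))
    (hy₂ : nonNbrs G V y₂ = ∅ → 2 ≤ #(nonNbrs H V y₂)) :
    (#(cliquePairs G H V V) : ℝ) ≤ pairBound #V := by
  have hxG : x ∈ nonNbrs G V v := by simp [hG]
  have hyH₁ : y₁ ∈ nonNbrs H V v := by simp [hH]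
  have hyH₂ : y₂ ∈ nonNbrs H V v := by simp [hH]
  have hxV := (mem_nonNbrs.1 hxG).1
  have hyV₁ := (mem_nonNbrs.1 hyH₁).1
  have hyv₁ := (mem_nonNbrs.1 hyH₁).2.1
  have hyV₂ := (mem_nonNbrs.1 hyH₂).1
  have hyv₂ := (mem_nonNbrs.1 hyH₂).2.1
  have hpos := pairBound_pos #V
  have hn3 : 3 ≤ #V := by
    have : #{v, y₁, y₂} ≤ #V := card_le_card (by grind)
    grind
  have e1 := pairBound_sub_one_of_odd hodd
  have e2 := pairBound_sub_two (n := #V) (by omega)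
  have e3 := pairBound_sub_three_of_odd hodd hn3
  -- The crude total is 1/3 + 2/7 + 3/7 = 22/21, so each case below has to save 1/21 in one of the
  -- three terms.
  have f0 := card_cliquePairs_le_split G H V v
  have f1 := h.left_le hv subset_rfl
  have f2 := h.right_le hv subset_rfl
  have f3 := h.neither_le hv
  rw [hG, card_singleton] at f1
  rw [hH, card_pair hy] at f2
  norm_num at f1 f2
  rw [e2] at f1
  rw [e3] at f2
  rw [e1] at f3
  by_cases h1 : x = y₁
  · subst h1
    have := h.neither_le_of_common hodd hv hy hG hH hx
    linarith
  by_cases h2 : x = y₂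
  · subst h2
    have := h.neither_le_of_common hodd hv hy.symm hG (by rw [hH, pair_comm]) hx
    linarith
  by_cases h3 : 2 ≤ #(nonNbrs H V x)
  · obtain ⟨T, hT, hTc⟩ := exists_subset_card_eq h3
    have hvx : v ∉ nonNbrs H V x := fun hvx => by
      have := mem_nonNbrs_comm hxV hvx
      simp [hH, h1, h2] at this
    have := h.left_le_of_nonNbr hv hxG hT (fun hvT => hvx (hT hvT))
    have hn4 : 4 ≤ #V := by
      have : #(insert v (insert x T)) ≤ #V := card_le_card (by
        have : T ⊆ V := fun x hx => (mem_nonNbrs.1 (hT hx)).1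
        grind)
      rw [card_insert_of_notMem, card_insert_of_notMem, hTc] at this
      · exact this
      · exact fun hxT => (mem_nonNbrs.1 (hT hxT)).2.1 rfl
      · have := (mem_nonNbrs.1 hxG).2.1
        grind
    rw [hTc, e2, pairBound_sub_four hn4] at this
    norm_num at this
    linarith
  have hx2 : 2 ≤ #(nonNbrs G V x) := by tauto
  by_cases h4 : nonNbrs G V y₁ = ∅
  · have := h.neither_le_of_three hodd hv h1 h2 hy hG hH hx2 (hy₁ h4)
    linarith
  by_cases h5 : nonNbrs G V y₂ = ∅
  · have := h.neither_le_of_three hodd hv h2 h1 hy.symm hG (by rw [hH, pair_comm]) hx2 (hy₂ h5)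
    linarith
  obtain ⟨s₁, hs₁⟩ := nonempty_iff_ne_empty.2 h4
  obtain ⟨s₂, hs₂⟩ := nonempty_iff_ne_empty.2 h5
  have key : ∀ y s, y ∈ V → y ≠ x → s ∈ nonNbrs G V y → s ≠ v := by
    rintro y s hyV hyx hs rfl
    have := mem_nonNbrs_comm hyV hs
    simp [hG] at this
    exact hyx this
  have := h.right_le_of_nonNbrs hodd hv hy hyH₁ hyH₂ hs₁ hs₂ (key _ _ hyV₁ (Ne.symm h1) hs₁)
    (key _ _ hyV₂ (Ne.symm h2) hs₂)
  linarith

end BranchBound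

/-! ### Excluding vertex types by parity, and closing the induction -/

/-- Passing from b + 2 to b + 4 multiplies the left side by 4(b + 6) / (6(b + 4)) ≤ 1, so only b ≤ 3
needs checking. -/
theorem zero_case_le {c : ℝ} {n : ℕ} (h0 : 1 ≤ n → pairBound (n - 1) ≤ c)
    (h1 : 2 ≤ n → 3 * pairBound (n - 2) ≤ c) (h2 : 3 ≤ n → 8 * pairBound (n - 3) ≤ c)
    (h3 : 4 ≤ n → 20 * pairBound (n - 4) ≤ c) :
    ∀ b : ℕ, b + 1 ≤ n → ((b : ℝ) + 2) / 2 * 2 ^ b * pairBound (n - (b + 1)) ≤ c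
  | 0, hb => by simpa using h0 hb
  | 1, hb => by
    have := h1 hb
    norm_num at *; linarith
  | 2, hb => by
    have := h2 hb
    norm_num at *; linarith
  | 3, hb => by
    have := h3 hb
    norm_num at *; linarith
  | b + 4, hb => by
    have ih := zero_case_le h0 h1 h2 h3 (b + 2) (by omega)
    have e : pairBound (n - (b + 2 + 1)) = 6 * pairBound (n - (b + 4 + 1)) := by
      rw [show n - (b + 2 + 1) = n - (b + 4 + 1) + 2 by omega, pairBound_add_two]
    rw [e] at ih
    refine le_trans ?_ ih
    have hpos : 0 < 2 ^ b * pairBound (n - (b + 4 + 1)) := by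
      have := pairBound_pos (n - (b + 4 + 1))
      positivity
    have hb0 : (0 : ℝ) ≤ b := by positivity
    push_cast
    rw [pow_add, pow_add]
    nlinarith

/-- If the vertices without `G`-non-neighbours are closed under `H`-non-adjacency, then one of
them has the least number of `H`-non-neighbours. -/
theorem exists_min_nonNbrs {α : Type*} {G H : SimpleGraph α} {V : Finset α} {v₀ : α} (hv₀ : v₀ ∈ V) (h₀ : nonNbrs G V v₀ = ∅)
    (hcl : ∀ v ∈ V, nonNbrs G V v = ∅ → ∀ y ∈ nonNbrs H V v, nonNbrs G V y = ∅) :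
    ∃ v ∈ V, nonNbrs G V v = ∅ ∧
      ∀ y ∈ nonNbrs H V v, #(nonNbrs H V v) ≤ #(nonNbrs H V y) := by
  classical
  obtain ⟨v, hv, hmin⟩ := exists_min_image (V.filter fun v => nonNbrs G V v = ∅)
    (fun v => #(nonNbrs H V v)) ⟨v₀, mem_filter.2 ⟨hv₀, h₀⟩⟩
  rw [mem_filter] at hv
  exact ⟨v, hv.1, hv.2, fun y hy =>
    hmin y (mem_filter.2 ⟨(mem_nonNbrs.1 hy).1, hcl v hv.1 hv.2 y hy⟩)⟩

section
variable {α : Type*} [DecidableEq α] {G H : SimpleGraph α} {V : Finset α}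

namespace BranchBound

theorem card_le_of_zero_odd (h : BranchBound G H V) (hodd : Odd #V) {v : α} (hv : v ∈ V)
    (hG : nonNbrs G V v = ∅)
    (hmin : ∀ y ∈ nonNbrs H V v, #(nonNbrs H V v) ≤ #(nonNbrs H V y)) :
    (#(cliquePairs G H V V) : ℝ) ≤ pairBound #V := by
  obtain ⟨hb, hle⟩ := h.card_le_of_zero hv hG hmin
  have hpos := pairBound_pos #V
  have e1 := pairBound_sub_one_of_odd hodd
  -- What remains after `pairBound (#V - 1)`, which is 3/7 of the total; b = 2 attains it.
  have := zero_case_le (c := 4 / 7 * pairBound #V) (n := #V)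
    (fun hn => by rw [e1]; linarith)
    (fun hn => by rw [pairBound_sub_two hn]; linarith)
    (fun hn => by rw [pairBound_sub_three_of_odd hodd hn]; linarith)
    (fun hn => by rw [pairBound_sub_four hn]; linarith) _ hb
  linarith

theorem card_lt_of_zero_even (h : BranchBound G H V) (heven : Even #V) {v : α} (hv : v ∈ V)
    (hG : nonNbrs G V v = ∅)
    (hmin : ∀ y ∈ nonNbrs H V v, #(nonNbrs H V v) ≤ #(nonNbrs H V y)) :
    (#(cliquePairs G H V V) : ℝ) < pairBound #V := by
  obtain ⟨hb, hle⟩ := h.card_le_of_zero hv hG hmin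
  have hpos := pairBound_pos #V
  have e1 := pairBound_sub_one_of_even heven (by omega)
  -- The largest of the four values is at b = 3, namely 20/36; then 7/18 + 5/9 = 17/18 leaves strict
  -- inequality.
  have := zero_case_le (c := 5 / 9 * pairBound #V) (n := #V)
    (fun hn => by rw [e1]; linarith)
    (fun hn => by rw [pairBound_sub_two hn]; linarith)
    (fun hn => by rw [pairBound_sub_three_of_even heven hn]; linarith)
    (fun hn => by rw [pairBound_sub_four hn]; linarith) _ hb
  linarith

theorem card_le_of_one_of_one (h : BranchBound G H V) {v : α} (hv : v ∈ V)
    (hG : #(nonNbrs G V v) = 1) (hH : #(nonNbrs H V v) = 1) :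
    (#(cliquePairs G H V V) : ℝ) ≤ pairBound #V := by
  obtain ⟨x, hx⟩ := card_eq_one.1 hG
  obtain ⟨y, hy⟩ := card_eq_one.1 hH
  obtain ⟨hn, hle⟩ := h.card_le_of_one_one hv hx hy le_rfl le_rfl
    (card_nonNbrs_pos hv (by simp [hx])) (card_nonNbrs_pos hv (by simp [hy]))
  have := h.left_le hv subset_rfl
  rw [hG] at this
  have e2 := pairBound_sub_two hn
  norm_num at this hle
  rw [e2] at this hle
  linarith

/-- In units of `pairBound #V`, type (≥2, ≥2) gives 3/7 + 8/14 = 1 and type (1, ≥3) gives 1/3 + 2/9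
+ 3/7 < 1. For (0, ≤1) the minimality needed holds automatically, as non-adjacency is symmetric. -/
theorem not_types_of_odd (h : BranchBound G H V) (hodd : Odd #V)
    (hlt : pairBound #V < #(cliquePairs G H V V)) {v : α} (hv : v ∈ V) :
    ¬ (2 ≤ #(nonNbrs G V v) ∧ 2 ≤ #(nonNbrs H V v)) ∧
    ¬ (#(nonNbrs G V v) = 0 ∧ #(nonNbrs H V v) ≤ 1) ∧
    ¬ (#(nonNbrs G V v) = 1 ∧ #(nonNbrs H V v) = 1) ∧
    ¬ (#(nonNbrs G V v) = 1 ∧ 3 ≤ #(nonNbrs H V v)) := by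
  have hpos := pairBound_pos #V
  have e1 := pairBound_sub_one_of_odd hodd
  refine ⟨?_, ?_, ?_, ?_⟩
  · rintro ⟨ha, hb⟩
    obtain ⟨hn, hle⟩ := h.card_le_of_two_two hv ha hb
    have e3 := pairBound_sub_three_of_odd hodd hn
    linarith
  · rintro ⟨ha, hb⟩
    exact hlt.not_ge (h.card_le_of_zero_odd hodd hv (card_eq_zero.1 ha)
      fun y hy => hb.trans (card_nonNbrs_pos hv hy))
  · rintro ⟨ha, hb⟩
    exact hlt.not_ge (h.card_le_of_one_of_one hv ha hb)
  · rintro ⟨ha, hb⟩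
    obtain ⟨T, hT, hTc⟩ := exists_subset_card_eq hb
    have hn : #(insert v T) ≤ #V := card_le_card
      (insert_subset hv fun x hx => (mem_nonNbrs.1 (hT hx)).1)
    rw [card_insert_of_notMem fun hvS => (mem_nonNbrs.1 (hT hvS)).2.1 rfl, hTc] at hn
    have f0 := card_cliquePairs_le_split G H V v
    have f1 := h.left_le hv subset_rfl
    have f2 := h.right_le hv hT
    have f3 := h.neither_le hv
    have e2 := pairBound_sub_two (n := #V) (by omega)
    have e4 := pairBound_sub_four hn
    rw [ha] at f1
    rw [hTc] at f2
    norm_num at f1 f2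
    linarith

theorem not_one_two_of_odd (h : BranchBound G H V) (hodd : Odd #V)
    (hlt : pairBound #V < #(cliquePairs G H V V)) {v : α} (hv : v ∈ V)
    (ha : #(nonNbrs G V v) = 1) : #(nonNbrs H V v) ≠ 2 := by
  intro hb
  obtain ⟨x, hx⟩ := card_eq_one.1 ha
  obtain ⟨y₁, y₂, hy, hyy⟩ := card_eq_two.1 hb
  have hxv : x ∈ nonNbrs G V v := by simp [hx]
  have hx1 := card_nonNbrs_pos hv hxv
  have hxV := (mem_nonNbrs.1 hxv).1
  have N := h.not_types_of_odd hodd hlt hxV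
  have N' := h.symm.not_types_of_odd hodd (by rwa [card_cliquePairs_comm]) hxV
  have key : ∀ y ∈ nonNbrs H V v, nonNbrs G V y = ∅ → 2 ≤ #(nonNbrs H V y) := by
    intro y hy h0
    have N := h.not_types_of_odd hodd hlt (mem_nonNbrs.1 hy).1
    rw [h0, card_empty] at N
    omega
  exact hlt.not_ge (h.card_le_of_one_two hodd hv hy hx hyy (by omega)
    (key y₁ (by simp [hyy])) (key y₂ (by simp [hyy])))

/-- A counterexample has only types (0, ≥2) and (≥2, 0). An H-non-neighbour of a vertex of the first
type is again of that type, so a vertex of least H-count exists there and `card_le_of_zero_odd`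
applies. -/
theorem card_le_of_odd (h : BranchBound G H V) (hodd : Odd #V) :
    (#(cliquePairs G H V V) : ℝ) ≤ pairBound #V := by
  by_contra! hlt
  have hlt' : pairBound #V < #(cliquePairs H G V V) := by rwa [card_cliquePairs_comm]
  have key : ∀ v ∈ V, #(nonNbrs G V v) = 0 ∧ 2 ≤ #(nonNbrs H V v) ∨
      2 ≤ #(nonNbrs G V v) ∧ #(nonNbrs H V v) = 0 := by
    intro v hv
    have N := h.not_types_of_odd hodd hlt hv
    have N' := h.symm.not_types_of_odd hodd hlt' hv
    have O := h.not_one_two_of_odd hodd hlt hv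
    have O' := h.symm.not_one_two_of_odd hodd hlt' hv
    omega
  obtain ⟨v, hv⟩ : V.Nonempty := card_pos.1 hodd.pos
  rcases key v hv with ⟨h0, -⟩ | ⟨-, h0⟩
  · obtain ⟨v, hv, hv0, hmin⟩ := exists_min_nonNbrs (H := H) hv (card_eq_zero.1 h0) (by
      intro v hv _ y hy
      have := card_nonNbrs_pos hv hy
      rw [← card_eq_zero]
      have := key y (mem_nonNbrs.1 hy).1
      omega)
    exact hlt.not_ge (h.card_le_of_zero_odd hodd hv hv0 hmin)
  · obtain ⟨v, hv, hv0, hmin⟩ := exists_min_nonNbrs (H := G) hv (card_eq_zero.1 h0) (by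
      intro v hv _ y hy
      have := card_nonNbrs_pos hv hy
      rw [← card_eq_zero]
      have := key y (mem_nonNbrs.1 hy).1
      omega)
    exact hlt'.not_ge (h.symm.card_le_of_zero_odd hodd hv hv0 hmin)

theorem not_types_of_even (h : BranchBound G H V) (heven : Even #V)
    (hle : pairBound #V ≤ #(cliquePairs G H V V)) {v : α} (hv : v ∈ V) :
    ¬ (2 ≤ #(nonNbrs G V v) ∧ 2 ≤ #(nonNbrs H V v)) ∧
    ¬ (#(nonNbrs G V v) = 0 ∧ #(nonNbrs H V v) ≤ 1) ∧
    ¬ (#(nonNbrs G V v) = 1 ∧ 2 ≤ #(nonNbrs H V v)) := by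
  have hpos := pairBound_pos #V
  have e1 := pairBound_sub_one_of_even heven (card_pos.2 ⟨v, hv⟩)
  refine ⟨?_, ?_, ?_⟩
  · rintro ⟨ha, hb⟩
    obtain ⟨hn, hle⟩ := h.card_le_of_two_two hv ha hb
    have e3 := pairBound_sub_three_of_even heven hn
    linarith
  · rintro ⟨ha, hb⟩
    exact hle.not_gt (h.card_lt_of_zero_even heven hv (card_eq_zero.1 ha)
      fun y hy => hb.trans (card_nonNbrs_pos hv hy))
  · rintro ⟨ha, hb⟩
    obtain ⟨T, hT, hTc⟩ := exists_subset_card_eq hb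
    have hn : #(insert v T) ≤ #V := card_le_card
      (insert_subset hv fun x hx => (mem_nonNbrs.1 (hT hx)).1)
    rw [card_insert_of_notMem fun hvS => (mem_nonNbrs.1 (hT hvS)).2.1 rfl, hTc] at hn
    have f0 := card_cliquePairs_le_split G H V v
    have f1 := h.left_le hv subset_rfl
    have f2 := h.right_le hv hT
    have f3 := h.neither_le hv
    have e2 := pairBound_sub_two (n := #V) (by omega)
    have e3 := pairBound_sub_three_of_even heven hn
    rw [ha] at f1
    rw [hTc] at f2
    norm_num at f1 f2
    linarith

/-- If the two non-neighbours x and y differ, some branch has slack: either x has a second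
G-non-neighbour, which shrinks the branch x ∈ K, or x has an H-non-neighbour other than v, which
shrinks the branch v ∈ K. -/
theorem eq_of_one_one (h : BranchBound G H V) (heven : Even #V)
    (hle : pairBound #V ≤ #(cliquePairs G H V V)) {v : α} (hv : v ∈ V)
    (ha : #(nonNbrs G V v) = 1) (hb : #(nonNbrs H V v) = 1) :
    ∃ u, nonNbrs G V v = {u} ∧ nonNbrs H V v = {u} := by
  have hle' : pairBound #V ≤ #(cliquePairs H G V V) := by rwa [card_cliquePairs_comm]
  obtain ⟨x, hx⟩ := card_eq_one.1 ha
  obtain ⟨y, hy⟩ := card_eq_one.1 hb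
  have hxv : x ∈ nonNbrs G V v := by simp [hx]
  have hyv : y ∈ nonNbrs H V v := by simp [hy]
  by_cases hxy : x = y
  · exact ⟨x, hx, hxy ▸ hy⟩
  exfalso
  have hpos := pairBound_pos #V
  have hx1 := card_nonNbrs_pos hv hxv
  have hy1 := card_nonNbrs_pos hv hyv
  have hxV := (mem_nonNbrs.1 hxv).1
  have f1 := h.left_le hv subset_rfl
  rw [ha] at f1
  norm_num at f1
  have hxa : #(nonNbrs G V x) = 1 := by
    by_contra hne
    obtain ⟨hn, hc⟩ := h.card_le_of_one_one hv hx hy (a := 2) (b := 1) (by simp) le_rfl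
      (by omega) hy1
    have hn3 : 3 ≤ #V := by
      rcases heven with ⟨m, hm⟩
      have : #(insert x (nonNbrs G V x)) ≤ #V := card_le_card
        (insert_subset hxV fun x hx => (mem_nonNbrs.1 hx).1)
      rw [card_insert_of_notMem fun hvS => (mem_nonNbrs.1 hvS).2.1 rfl] at this
      omega
    have e2 := pairBound_sub_two hn
    have e3 := pairBound_sub_three_of_even heven hn3
    norm_num at hc
    linarith
  have N := h.not_types_of_even heven hle hxV
  have N' := h.symm.not_types_of_even heven hle' hxV
  obtain ⟨t, ht⟩ := card_pos.1 (show 0 < #(nonNbrs H V x) by omega)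
  have htv : t ≠ v := by
    rintro rfl
    have := mem_nonNbrs_comm hxV ht
    rw [hy, mem_singleton] at this
    exact hxy this
  have f2 := h.left_le_of_nonNbr hv hxv (T := {t}) (by simpa using ht) (by simpa using htv.symm)
  obtain ⟨hn, hc⟩ := h.card_le_of_one_one hv hx hy le_rfl le_rfl hx1 hy1
  have hn3 : 3 ≤ #V := by
    have : #{v, x, t} ≤ #V := card_le_card (by
      have := (mem_nonNbrs.1 ht).1
      grind)
    have := (mem_nonNbrs.1 ht).2.1
    have := (mem_nonNbrs.1 hxv).2.1
    grind
  have e2 := pairBound_sub_two hn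
  have e3 := pairBound_sub_three_of_even heven hn3
  norm_num at hc f2
  linarith

/-- In the extremal even case the non-adjacency graphs are equal perfect matchings. -/
theorem matching_of_even (h : BranchBound G H V) (heven : Even #V)
    (hle : pairBound #V ≤ #(cliquePairs G H V V)) {v : α} (hv : v ∈ V) :
    ∃ u, nonNbrs G V v = {u} ∧ nonNbrs H V v = {u} := by
  have hle' : pairBound #V ≤ #(cliquePairs H G V V) := by rwa [card_cliquePairs_comm]
  have key : ∀ v ∈ V, #(nonNbrs G V v) = 0 ∨ #(nonNbrs H V v) = 0 ∨
      #(nonNbrs G V v) = 1 ∧ #(nonNbrs H V v) = 1 := by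
    intro v hv
    have N := h.not_types_of_even heven hle hv
    have N' := h.symm.not_types_of_even heven hle' hv
    omega
  -- A vertex of type (1, 1) has the same partner in both graphs, so it cannot be H-non-adjacent to
  -- a vertex without G-non-neighbours. This closes the class of type (0, ·) vertices.
  have hswap : ∀ v ∈ V, ∀ y ∈ V, #(nonNbrs G V y) = 1 → #(nonNbrs H V y) = 1 →
      (v ∈ nonNbrs G V y ↔ v ∈ nonNbrs H V y) := by
    intro v hv y hy h1 h2
    obtain ⟨u, hu1, hu2⟩ := h.eq_of_one_one heven hle hy h1 h2
    rw [hu1, hu2]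
  refine h.eq_of_one_one heven hle hv ?_ ?_ <;> by_contra hne
  all_goals
    have hz : #(nonNbrs G V v) = 0 ∨ #(nonNbrs H V v) = 0 := by
      have := key v hv
      omega
    rcases hz with h0 | h0
    · obtain ⟨v, hv, hv0, hmin⟩ := exists_min_nonNbrs (H := H) hv (card_eq_zero.1 h0) (by
        intro v hv hv0 y hy
        have hpos := card_nonNbrs_pos hv hy
        rw [← card_eq_zero]
        rcases key y (mem_nonNbrs.1 hy).1 with h1 | h1 | ⟨h1, h2⟩
        · exact h1
        · omega
        · have := mem_nonNbrs_comm (mem_nonNbrs.1 hy).1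
            ((hswap v hv y (mem_nonNbrs.1 hy).1 h1 h2).2 (mem_nonNbrs_comm hv hy))
          simp [hv0] at this)
      exact hle.not_gt (h.card_lt_of_zero_even heven hv hv0 hmin)
    · obtain ⟨v, hv, hv0, hmin⟩ := exists_min_nonNbrs (H := G) hv (card_eq_zero.1 h0) (by
        intro v hv hv0 y hy
        have hpos := card_nonNbrs_pos hv hy
        rw [← card_eq_zero]
        rcases key y (mem_nonNbrs.1 hy).1 with h1 | h1 | ⟨h1, h2⟩
        · omega
        · exact h1
        · have := mem_nonNbrs_comm (mem_nonNbrs.1 hy).1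
            ((hswap v hv y (mem_nonNbrs.1 hy).1 h1 h2).1 (mem_nonNbrs_comm hv hy))
          simp [hv0] at this)
      exact hle'.not_gt (h.symm.card_lt_of_zero_even heven hv hv0 hmin)

theorem card_le (h : BranchBound G H V) :
    (#(cliquePairs G H V V) : ℝ) ≤ pairBound #V := by
  rcases Nat.even_or_odd #V with heven | hodd
  · by_contra! hlt
    rcases V.eq_empty_or_nonempty with rfl | ⟨v, hv⟩
    · have h1 : cliquePairs G H ∅ ∅ ⊆ {(∅, ∅)} := by
        intro z hz
        have := mem_cliquePairs.1 hz
        simp only [subset_empty] at this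
        exact mem_singleton.2 (Prod.ext this.1 this.2.1)
      have h2 := card_le_card h1
      rw [card_singleton] at h2
      have h3 : (#(cliquePairs G H ∅ ∅) : ℝ) ≤ 1 := by exact_mod_cast h2
      simp [pairBound] at hlt
      omega
    · obtain ⟨u, h1, h2⟩ := h.matching_of_even heven hlt.le hv
      exact hlt.not_ge (h.card_le_of_one_of_one hv (by simp [h1]) (by simp [h2]))
  · exact h.card_le_of_odd hodd

end BranchBound

/-- The only choice for v is to be in K or not, which accounts for the factor 2 per vertex of the
symmetric difference. -/
theorem card_cliquePairs_le_of_mem_sdiff {U W : Finset α} {v : α} (hvU : v ∈ U) (hvW : v ∉ W)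
    (ih : ∀ U' ⊆ U \ {v}, ∀ W' ⊆ W, (#(cliquePairs G H U' W') : ℝ) ≤ pairWeight U' W') :
    (#(cliquePairs G H U W) : ℝ) ≤ pairWeight U W := by
  have h0 := (cliquePairs G H U W).card_filter_le_add (fun _ => True) (fun z => v ∈ z.1)
    (fun z => v ∉ z.1) (fun z _ _ => em _)
  rw [filter_true] at h0
  have key : ∀ (p : Finset α × Finset α → Prop) [DecidablePred p] (I : Finset α), I ⊆ {v} →
      (∀ z, p z → (v ∈ z.1 ↔ v ∈ I)) →
      (#((cliquePairs G H U W).filter p) : ℝ) ≤ pairWeight (U \ {v}) W := by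
    intro p _ I hI hp
    obtain ⟨U', hU', W', hW', hle⟩ := card_le_card_cliquePairs
      ((cliquePairs G H U W).filter p) (filter_subset _ _) {v} ∅ I ∅
      (fun z hz x hx => by
        rw [mem_singleton] at hx
        subst hx
        exact hp z (mem_filter.1 hz).2) (by simp) hI (by simp)
    rw [sdiff_empty] at hW'
    exact (Nat.cast_le.2 hle).trans ((ih U' hU' W' hW').trans (pairWeight_mono hU' hW'))
  have h1 := key (fun z => v ∈ z.1) {v} subset_rfl (by simp)
  have h2 := key (fun z => v ∉ z.1) ∅ (by simp) (by simp)
  have h3 : pairWeight U W = 2 * pairWeight (U \ {v}) W := by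
    have e1 : (U \ {v}) ∩ W = U ∩ W := by grind
    have e2 : U ∪ W = insert v ((U \ {v}) ∪ W) := by grind
    have e3 : #(U ∩ W) ≤ #((U \ {v}) ∪ W) := card_le_card (by grind)
    rw [pairWeight, pairWeight, e1, e2, card_insert_of_notMem (by grind),
      Nat.sub_add_comm e3, pow_succ]
    ring
  linarith

theorem card_cliquePairs_le (G H : SimpleGraph α) (U W : Finset α) :
    (#(cliquePairs G H U W) : ℝ) ≤ pairWeight U W := by
  induction hn : #U + #W using Nat.strong_induction_on generalizing U W G H with
  | _ n ih =>
    by_cases hUW : U = W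
    · subst hUW
      have hB : BranchBound G H U := by
        intro U' hU' W' hW' hne
        refine ih _ ?_ _ _ _ _ rfl
        have h1 := card_le_card hU'
        have h2 := card_le_card hW'
        rcases hne with hne | hne
        · have := card_lt_card (hU'.ssubset_of_ne hne)
          omega
        · have := card_lt_card (hW'.ssubset_of_ne hne)
          omega
      simpa [pairWeight] using hB.card_le
    · have hex : (∃ v ∈ U, v ∉ W) ∨ ∃ v ∈ W, v ∉ U := by
        by_contra! hcon
        exact hUW (subset_antisymm hcon.1 hcon.2)
      rcases hex with ⟨v, hv, hv'⟩ | ⟨v, hv, hv'⟩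
      · refine card_cliquePairs_le_of_mem_sdiff hv hv' fun U' hU' W' hW' => ih _ ?_ _ _ _ _ rfl
        have h1 := card_lt_card (hU'.trans_ssubset (sdiff_singleton_eq_erase v U ▸ erase_ssubset hv))
        have h2 := card_le_card hW'
        omega
      · rw [card_cliquePairs_comm, pairWeight_comm]
        refine card_cliquePairs_le_of_mem_sdiff hv hv' fun U' hU' W' hW' => ih _ ?_ _ _ _ _ rfl
        have h1 := card_lt_card (hU'.trans_ssubset (sdiff_singleton_eq_erase v W ▸ erase_ssubset hv))
        have h2 := card_le_card hW'
        omega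

theorem branchBound (G H : SimpleGraph α) (V : Finset α) : BranchBound G H V :=
  fun U _ W _ _ => card_cliquePairs_le G H U W

end

/-! ### Inequalities for the chain polytope and the twinned chain polytope -/

/-- The comparability graph of `P`, on the index set. -/
def indexGraph {d : ℕ} {P : Type*} [PartialOrder P] (p : Fin d ≃ P) : SimpleGraph (Fin d) :=
  (comparabilityGraph P).comap p

theorem indexGraph_adj {d : ℕ} {P : Type*} [PartialOrder P] {p : Fin d ≃ P} {i j : Fin d} :
    (indexGraph p).Adj i j ↔ i ≠ j ∧ (p i ≤ p j ∨ p j ≤ p i) := by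
  simp [indexGraph, comparabilityGraph]

theorem indicatorVec_apply {d : ℕ} {P : Type*} (p : Fin d ≃ P) (A : Set P) (i : Fin d)
    [Decidable (p i ∈ A)] : indicatorVec p A i = if p i ∈ A then 1 else 0 := by
  classical
  simp [indicatorVec, Set.indicator_apply]

theorem indicatorVec_mem_chainPolytope {d : ℕ} {P : Type*} [PartialOrder P] (p : Fin d ≃ P)
    {A : Set P} (hA : IsAntichain (· ≤ ·) A) : indicatorVec p A ∈ chainPolytope p :=
  subset_convexHull ℝ _ ⟨A, hA, rfl⟩

theorem zero_mem_chainPolytope {d : ℕ} {P : Type*} [PartialOrder P] (p : Fin d ≃ P) :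
    0 ∈ chainPolytope p := by
  have := indicatorVec_mem_chainPolytope p (A := ∅) (Set.subsingleton_empty.isAntichain _)
  rwa [show indicatorVec p ∅ = 0 by ext i; simp [indicatorVec]] at this

theorem single_mem_chainPolytope {d : ℕ} {P : Type*} [PartialOrder P] (p : Fin d ≃ P)
    (i : Fin d) : Pi.single i 1 ∈ chainPolytope p := by
  classical
  have := indicatorVec_mem_chainPolytope p (A := {p i}) (Set.subsingleton_singleton.isAntichain _)
  rwa [show indicatorVec p {p i} = Pi.single i 1 by
    ext j; simp [indicatorVec_apply, Pi.single_apply]] at this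

theorem single_add_single_mem_chainPolytope {d : ℕ} {P : Type*} [PartialOrder P] (p : Fin d ≃ P)
    {i j : Fin d} (hij : i ≠ j) (h : ¬ (indexGraph p).Adj i j) :
    Pi.single i 1 + Pi.single j 1 ∈ chainPolytope p := by
  classical
  rw [indexGraph_adj] at h
  push Not at h
  have := indicatorVec_mem_chainPolytope p (A := {p i, p j}) (by
    rintro a (rfl | rfl) b (rfl | rfl) hab hle
    · exact hab rfl
    · exact (h hij).1 hle
    · exact (h hij).2 hle
    · exact hab rfl)
  rwa [show indicatorVec p {p i, p j} = Pi.single i 1 + Pi.single j 1 by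
    ext k
    simp only [indicatorVec_apply, Set.mem_insert_iff, Set.mem_singleton_iff, Pi.add_apply,
      Pi.single_apply, p.apply_eq_iff_eq]
    grind] at this

/-- A nonnegative vector with all chain sums at most `μ` lies in `μ • 𝒞(P)`. -/
theorem exists_smul_mem_chainPolytope {d : ℕ} {P : Type*} [PartialOrder P] (p : Fin d ≃ P)
    (x : Fin d → ℝ) (μ : ℝ) (hx : ∀ i, 0 ≤ x i)
    (hK : ∀ K : Finset (Fin d), (∀ i ∈ K, ∀ j ∈ K, i ≠ j → (indexGraph p).Adj i j) →
      ∑ i ∈ K, x i ≤ μ) :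
    ∃ y ∈ chainPolytope p, x = μ • y := by
  classical
  induction hn : #(univ.filter fun i => x i ≠ 0) using Nat.strong_induction_on
    generalizing x μ with
  | _ n ih =>
  set s : Finset (Fin d) := univ.filter fun i => x i ≠ 0 with hs
  have mem_s : ∀ i, i ∈ s ↔ x i ≠ 0 := by simp [hs]
  rcases s.eq_empty_or_nonempty with h0 | hne
  · refine ⟨0, zero_mem_chainPolytope p, ?_⟩
    ext i
    have : i ∉ s := by simp [h0]
    simpa [mem_s] using this
  -- Greedy peeling: subtract the indicator of the minimal elements of the support, scaled by the
  -- least value there. A coordinate vanishes, so the support shrinks.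
  set A : Finset (Fin d) := s.filter fun i => ∀ j ∈ s, p j ≤ p i → j = i with hA
  have below : ∀ i ∈ s, ∃ a ∈ A, p a ≤ p i := by
    intro i hi
    obtain ⟨b, hb, hmin⟩ := (s.image p).exists_le_minimal (mem_image_of_mem p hi)
    obtain ⟨a, ha, rfl⟩ := mem_image.1 hmin.1
    refine ⟨a, mem_filter.2 ⟨ha, fun j hj hle => ?_⟩, hb⟩
    exact p.injective (le_antisymm hle (hmin.2 (mem_image_of_mem p hj) hle))
  have hAs : A ⊆ s := filter_subset _ _
  have hAne : A.Nonempty := by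
    obtain ⟨i, hi⟩ := hne
    obtain ⟨a, ha, -⟩ := below i hi
    exact ⟨a, ha⟩
  obtain ⟨m, hm, hmin⟩ := exists_min_image A x hAne
  have hεpos : 0 < x m := lt_of_le_of_ne (hx m) ((mem_s m).1 (hAs hm)).symm
  have hAanti : ∀ a ∈ A, ∀ b ∈ A, p a ≤ p b → a = b := fun a ha b hb hle =>
    (mem_filter.1 hb).2 a (hAs ha) hle
  set e : Fin d → ℝ := fun i => if i ∈ A then 1 else 0 with he
  have hemem : e ∈ chainPolytope p := by
    have := indicatorVec_mem_chainPolytope p (A := p '' A) (by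
      rintro _ ⟨a, ha, rfl⟩ _ ⟨b, hb, rfl⟩ hab hle
      exact hab (congrArg p (hAanti a ha b hb hle)))
    rwa [show indicatorVec p (p '' A) = e by
      ext i
      rw [indicatorVec_apply]
      simp [he]] at this
  set x' : Fin d → ℝ := fun i => x i - x m * e i with hx'
  have hx'0 : ∀ i, 0 ≤ x' i := by
    intro i
    by_cases hi : i ∈ A
    · have := hmin i hi
      simp [hx', he, hi, this]
    · simp [hx', he, hi, hx i]
  have hx's : ∀ i, x' i ≠ 0 → i ∈ s := by
    intro i hi
    by_contra his
    have h1 : i ∉ A := fun h => his (hAs h)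
    rw [mem_s, not_not] at his
    exact hi (by simp [hx', he, h1, his])
  have hK' : ∀ K : Finset (Fin d), (∀ i ∈ K, ∀ j ∈ K, i ≠ j → (indexGraph p).Adj i j) →
      ∑ i ∈ K, x' i ≤ μ - x m := by
    intro K hKc
    have hdef : ∀ L : Finset (Fin d), ∑ i ∈ L, x' i = ∑ i ∈ L, x i - x m * ∑ i ∈ L, e i := by
      intro L
      simp [hx', sum_sub_distrib, mul_sum]
    have he0 : ∀ i, 0 ≤ e i := fun i => by
      simp only [he]
      split_ifs <;> norm_num
    have hmeet : ∀ L : Finset (Fin d), (∀ i ∈ L, ∀ j ∈ L, i ≠ j → (indexGraph p).Adj i j) →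
        ∀ a ∈ A, a ∈ L → ∑ i ∈ L, x' i ≤ μ - x m := by
      intro L hL a ha haL
      have h1 : (1 : ℝ) ≤ ∑ i ∈ L, e i := by
        have := single_le_sum (f := e) (fun i _ => he0 i) haL
        simpa [he, ha] using this
      have := hK L hL
      rw [hdef]
      nlinarith
    set K₁ := K.filter (· ∈ s) with hK₁
    have hsum : ∑ i ∈ K, x' i = ∑ i ∈ K₁, x' i := by
      rw [hK₁, sum_filter_of_ne fun i _ hi => hx's i hi]
    have hK₁c : ∀ i ∈ K₁, ∀ j ∈ K₁, i ≠ j → (indexGraph p).Adj i j := fun i hi j hj =>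
      hKc i (mem_filter.1 hi).1 j (mem_filter.1 hj).1
    rw [hsum]
    rcases K₁.eq_empty_or_nonempty with h0 | hne
    · have := hK {m} (by simp)
      rw [sum_singleton] at this
      simp [h0, this]
    -- A chain inside the support extends downwards by an element of A without lowering its sum, and
    -- every chain meeting A loses at least `x m`.
    · obtain ⟨b, hbmin⟩ := (K₁.image p).exists_minimal (hne.image p)
      obtain ⟨k, hk, rfl⟩ := mem_image.1 hbmin.1
      obtain ⟨a, ha, hak⟩ := below k (mem_filter.1 hk).2
      have hale : ∀ j ∈ K₁, p a ≤ p j := by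
        intro j hj
        by_cases hkj : k = j
        · exact hkj ▸ hak
        · rcases (indexGraph_adj.1 (hK₁c k hk j hj hkj)).2 with h | h
          · exact hak.trans h
          · exact hak.trans (hbmin.2 (mem_image_of_mem p hj) h)
      refine (sum_le_sum_of_subset_of_nonneg (subset_insert a K₁) fun i _ _ => hx'0 i).trans
        (hmeet (insert a K₁) ?_ a ha (mem_insert_self _ _))
      intro i hi j hj hij
      rcases mem_insert.1 hi with hia | hiK <;> rcases mem_insert.1 hj with hja | hjK
      · exact absurd (hia.trans hja.symm) hij
      · exact indexGraph_adj.2 ⟨hij, Or.inl (hia ▸ hale j hjK)⟩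
      · exact indexGraph_adj.2 ⟨hij, Or.inr (hja ▸ hale i hiK)⟩
      · exact hK₁c i hiK j hjK hij
  have hcard : #(univ.filter fun i => x' i ≠ 0) < n := by
    rw [← hn]
    refine card_lt_card (ssubset_iff_of_subset ?_ |>.2 ⟨m, hAs hm, ?_⟩)
    · intro i hi
      exact hx's i (mem_filter.1 hi).2
    · simp [hx', he, hm]
  obtain ⟨y, hy, hxy⟩ := ih _ hcard x' (μ - x m) hx'0 hK' rfl
  have hμ : x m ≤ μ := by
    have := hK {m} (by simp)
    simpa using this
  have hμ0 : 0 < μ := hεpos.trans_le hμ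
  refine ⟨((μ - x m) / μ) • y + (x m / μ) • e,
    (convex_convexHull ℝ _) hy hemem (by
      have : 0 ≤ μ - x m := by linarith
      positivity) (by positivity) (by field_simp; ring), ?_⟩
  ext i
  have h1 : x' i = (μ - x m) * y i := by rw [hxy]; simp
  have h2 : x i = x' i + x m * e i := by simp [hx']
  simp only [Pi.smul_apply, Pi.add_apply, smul_eq_mul]
  rw [h2, h1]
  field_simp

/-- The linear functional `x ↦ x(K) - x(L)`. -/
noncomputable def pairFunctional {d : ℕ} (K L : Finset (Fin d)) : (Fin d → ℝ) →ₗ[ℝ] ℝ :=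
  ∑ i ∈ K, LinearMap.proj i - ∑ i ∈ L, LinearMap.proj i

theorem pairFunctional_apply {d : ℕ} (K L : Finset (Fin d)) (x : Fin d → ℝ) :
    pairFunctional K L x = ∑ i ∈ K, x i - ∑ i ∈ L, x i := by
  simp [pairFunctional, LinearMap.sum_apply]

theorem pairFunctional_single {d : ℕ} (K L : Finset (Fin d)) (i : Fin d) :
    pairFunctional K L (Pi.single i 1) = (if i ∈ K then 1 else 0) - if i ∈ L then 1 else 0 := by
  simp [pairFunctional_apply]

theorem sum_le_one_of_mem_chainPolytope {d : ℕ} {P : Type*} [PartialOrder P] {p : Fin d ≃ P}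
    {K L : Finset (Fin d)} (hK : ∀ i ∈ K, ∀ j ∈ K, i ≠ j → (indexGraph p).Adj i j)
    {x : Fin d → ℝ} (hx : x ∈ chainPolytope p) : pairFunctional K L x ≤ 1 := by
  classical
  have hsub : chainPolytope p ⊆ {x | pairFunctional K L x ≤ 1} := by
    refine convexHull_min ?_ (convex_halfSpace_le (pairFunctional K L).isLinear 1)
    rintro _ ⟨A, hA, rfl⟩
    rw [Set.mem_ofPred_eq, pairFunctional_apply]
    have h1 : 0 ≤ ∑ i ∈ L, indicatorVec p A i := sum_nonneg fun i _ => by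
      rw [indicatorVec_apply]
      split_ifs <;> norm_num
    have h2 : ∑ i ∈ K, indicatorVec p A i ≤ 1 := by
      simp only [indicatorVec_apply, sum_boole]
      rw [Nat.cast_le_one, card_le_one]
      intro a ha b hb
      rw [mem_filter] at ha hb
      by_contra hab
      rcases (indexGraph_adj.1 (hK a ha.1 b hb.1 hab)).2 with h | h
      · exact hab (p.injective (hA.eq ha.2 hb.2 h))
      · exact hab (p.injective (hA.eq hb.2 ha.2 h)).symm
    linarith
  exact hsub hx

section
variable {d : ℕ} {P Q : Type*} [PartialOrder P] [PartialOrder Q] (p : Fin d ≃ P) (q : Fin d ≃ Q)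

theorem left_subset_twinned : chainPolytope p ⊆ twinnedChainPolytope p q :=
  Set.subset_union_left.trans (subset_convexHull ℝ _)

theorem neg_mem_twinned {x : Fin d → ℝ} (hx : x ∈ chainPolytope q) :
    -x ∈ twinnedChainPolytope p q :=
  subset_convexHull ℝ _ (Or.inr (by simpa using hx))

/-- The inequality description of the twinned chain polytope. -/
theorem mem_twinnedChainPolytope_iff {x : Fin d → ℝ} :
    x ∈ twinnedChainPolytope p q ↔ ∀ K L : Finset (Fin d),
      (∀ i ∈ K, ∀ j ∈ K, i ≠ j → (indexGraph p).Adj i j) →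
      (∀ i ∈ L, ∀ j ∈ L, i ≠ j → (indexGraph q).Adj i j) → (∀ i ∈ K, i ∉ L) →
      pairFunctional K L x ≤ 1 := by
  classical
  constructor
  · intro hx K L hK hL _
    have hsub : twinnedChainPolytope p q ⊆ {x | pairFunctional K L x ≤ 1} := by
      refine convexHull_min ?_ (convex_halfSpace_le (pairFunctional K L).isLinear 1)
      rintro y (hy | hy)
      · exact sum_le_one_of_mem_chainPolytope hK hy
      · have := sum_le_one_of_mem_chainPolytope (K := L) (L := K) hL hy
        rw [Set.mem_ofPred_eq]
        simp only [pairFunctional_apply, Pi.neg_apply, sum_neg_distrib] at this ⊢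
        linarith
    exact hsub hx
  · intro h
    have max_clique : ∀ (G : SimpleGraph (Fin d)) (w : Fin d → ℝ), ∃ K : Finset (Fin d),
        (∀ i ∈ K, ∀ j ∈ K, i ≠ j → G.Adj i j) ∧ ∀ K' : Finset (Fin d),
        (∀ i ∈ K', ∀ j ∈ K', i ≠ j → G.Adj i j) → ∑ i ∈ K', w i ≤ ∑ i ∈ K, w i := by
      intro G w
      obtain ⟨K, hK, hmax⟩ := exists_max_image
        (univ.filter fun K : Finset (Fin d) => ∀ i ∈ K, ∀ j ∈ K, i ≠ j → G.Adj i j)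
        (fun K => ∑ i ∈ K, w i) ⟨∅, by simp⟩
      exact ⟨K, (mem_filter.1 hK).2, fun K' hK' => hmax K' (mem_filter.2 ⟨mem_univ _, hK'⟩)⟩
    obtain ⟨K, hK, hKmax⟩ := max_clique (indexGraph p) fun i => max (x i) 0
    obtain ⟨L, hL, hLmax⟩ := max_clique (indexGraph q) fun i => max (-x i) 0
    set a := ∑ i ∈ K, max (x i) 0 with ha
    set b := ∑ i ∈ L, max (-x i) 0 with hb
    have ha0 : 0 ≤ a := sum_nonneg fun i _ => le_max_right _ _
    have hb0 : 0 ≤ b := sum_nonneg fun i _ => le_max_right _ _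
    -- Restricting the maximal cliques to where x is positive, resp. negative, makes them disjoint
    -- without changing the sums.
    have hab : a + b ≤ 1 := by
      have := h (K.filter fun i => 0 < x i) (L.filter fun i => x i < 0)
        (fun i hi j hj => hK i (mem_filter.1 hi).1 j (mem_filter.1 hj).1)
        (fun i hi j hj => hL i (mem_filter.1 hi).1 j (mem_filter.1 hj).1)
        (fun i hi hi' => by
          rw [mem_filter] at hi hi'
          linarith [hi.2, hi'.2])
      rw [pairFunctional_apply, sum_filter, sum_filter, sub_eq_add_neg, ← sum_neg_distrib] at this
      refine le_trans (le_of_eq ?_) this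
      rw [ha, hb]
      congr 1 <;> refine sum_congr rfl fun i _ => ?_
      · split_ifs with h0
        · exact max_eq_left h0.le
        · exact max_eq_right (not_lt.1 h0)
      · split_ifs with h0
        · exact max_eq_left (by linarith)
        · rw [neg_zero]
          exact max_eq_right (by linarith)
    obtain ⟨y, hy, hxy⟩ := exists_smul_mem_chainPolytope p _ a (fun i => le_max_right (x i) 0) hKmax
    obtain ⟨z, hz, hxz⟩ := exists_smul_mem_chainPolytope q _ b (fun i => le_max_right (-x i) 0) hLmax
    have hconv : Convex ℝ (twinnedChainPolytope p q) := convex_convexHull ℝ _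
    have hy' := left_subset_twinned p q hy
    have hz' := neg_mem_twinned p q hz
    have h0 := left_subset_twinned p q (zero_mem_chainPolytope p)
    -- x = a·y - b·z, with the remaining weight put on the origin.
    have := hconv.sum_mem (t := univ) (w := ![a, b, 1 - a - b]) (z := ![y, -z, 0])
      (by intro i _; fin_cases i <;> simp <;> linarith)
      (by simp [Fin.sum_univ_three]) (by intro i _; fin_cases i <;> simp [hy', hz', h0])
    convert this using 1
    ext i
    have h1 := congrFun hxy i
    have h2 := congrFun hxz i
    simp only [Pi.smul_apply, smul_eq_mul] at h1 h2
    simp only [Fin.sum_univ_three, Matrix.cons_val_zero, Matrix.cons_val_one, Matrix.cons_val,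
      smul_zero, Pi.zero_apply, add_zero, Pi.add_apply, Pi.smul_apply, Pi.neg_apply, smul_eq_mul, mul_neg]
    rw [← h1, ← h2]
    rcases le_total 0 (x i) with h | h
    · rw [max_eq_left h, max_eq_right (by linarith)]; ring
    · rw [max_eq_right h, max_eq_left (by linarith)]; ring

end

/-! ### Facets correspond to clique pairs -/

/-- The hyperplane g = 1 misses the origin, so passing from affine to linear span adds one
dimension. An empty F forces d = 0, where the convention -1 agrees. -/
theorem convDim_of_span_eq_top {d : ℕ} {F : Set (Fin d → ℝ)} (g : (Fin d → ℝ) →ₗ[ℝ] ℝ)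
    (hg : ∀ x ∈ F, g x = 1) (hF : Submodule.span ℝ F = ⊤) : convDim F = (d : ℤ) - 1 := by
  rw [convDim]
  split_ifs with h
  · subst h
    rw [Submodule.span_empty] at hF
    have := congrArg (fun S : Submodule ℝ (Fin d → ℝ) => Module.finrank ℝ S) hF
    simp at this
    omega
  · obtain ⟨x₀, hx₀⟩ := Set.nonempty_iff_ne_empty.2 h
    have h1 : vectorSpan ℝ F ≤ LinearMap.ker g := by
      rw [vectorSpan_def, Submodule.span_le]
      rintro _ ⟨a, ha, b, hb, rfl⟩
      simp [hg a ha, hg b hb]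
    have h2 : LinearMap.ker g ≠ ⊤ := fun htop => by
      have : x₀ ∈ LinearMap.ker g := htop ▸ Submodule.mem_top
      simp [hg x₀ hx₀] at this
    have h3 := Submodule.finrank_lt h2
    have h4 := Submodule.finrank_mono h1
    have h5 : vectorSpan ℝ F ⊔ Submodule.span ℝ {x₀} = ⊤ := by
      rw [eq_top_iff, ← hF, Submodule.span_le]
      intro x hx
      have := Submodule.add_mem_sup (vsub_mem_vectorSpan ℝ hx hx₀)
        (Submodule.mem_span_singleton_self (R := ℝ) x₀)
      simpa using this
    have h6 := Submodule.finrank_add_le_finrank_add_finrank (vectorSpan ℝ F)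
      (Submodule.span ℝ {x₀})
    have h7 := finrank_span_le_card (R := ℝ) ({x₀} : Set (Fin d → ℝ))
    rw [h5, finrank_top] at h6
    simp only [Module.finrank_fin_fun, Set.toFinset_singleton, card_singleton] at h3 h6 h7
    omega

theorem span_eq_top_of_single {d : ℕ} {F : Submodule ℝ (Fin d → ℝ)}
    (h : ∀ i, Pi.single i 1 ∈ F) : F = ⊤ := by
  rw [eq_top_iff, ← (Pi.basisFun ℝ (Fin d)).span_eq, Submodule.span_le]
  rintro _ ⟨i, rfl⟩
  simpa using h i

section
variable {d : ℕ} {P Q : Type*} [PartialOrder P] [PartialOrder Q] (p : Fin d ≃ P) (q : Fin d ≃ Q)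

theorem convDim_twinnedChainPolytope : convDim (twinnedChainPolytope p q) = d := by
  have h0 := left_subset_twinned p q (zero_mem_chainPolytope p)
  rw [convDim, if_neg (Set.nonempty_iff_ne_empty.1 ⟨0, h0⟩), span_eq_top_of_single (F := vectorSpan ℝ _),
    finrank_top, Module.finrank_fin_fun]
  intro i
  have := vsub_mem_vectorSpan ℝ (left_subset_twinned p q (single_mem_chainPolytope p i)) h0
  simpa using this

/-- The face of the twinned chain polytope where `x(K) - x(L) = 1`. -/
def pairFace (K L : Finset (Fin d)) : Set (Fin d → ℝ) :=
  {x | x ∈ twinnedChainPolytope p q ∧ pairFunctional K L x = 1}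

variable {p q}

theorem pairFunctional_le_one {z : Finset (Fin d) × Finset (Fin d)}
    (hz : z ∈ cliquePairs (indexGraph p) (indexGraph q) univ univ) {x : Fin d → ℝ}
    (hx : x ∈ twinnedChainPolytope p q) : pairFunctional z.1 z.2 x ≤ 1 := by
  rw [mem_cliquePairs] at hz
  exact (mem_twinnedChainPolytope_iff p q).1 hx _ _ hz.2.2.1 hz.2.2.2.1 hz.2.2.2.2.1

theorem span_pairFace {z : Finset (Fin d) × Finset (Fin d)}
    (hz : z ∈ cliquePairs (indexGraph p) (indexGraph q) univ univ) :
    Submodule.span ℝ (pairFace p q z.1 z.2) = ⊤ := by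
  obtain ⟨-, -, hK, hL, hKL, hext⟩ := mem_cliquePairs.1 hz
  have h1 : ∀ k ∈ z.1, Pi.single k 1 ∈ Submodule.span ℝ (pairFace p q z.1 z.2) := fun k hk =>
    Submodule.subset_span ⟨left_subset_twinned p q (single_mem_chainPolytope p k), by
      simp [pairFunctional_single, hk, hKL k hk]⟩
  have h2 : ∀ l ∈ z.2, Pi.single l 1 ∈ Submodule.span ℝ (pairFace p q z.1 z.2) := fun l hl => by
    have hl' : l ∉ z.1 := fun h => hKL l h hl
    have : -Pi.single l 1 ∈ Submodule.span ℝ (pairFace p q z.1 z.2) :=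
      Submodule.subset_span ⟨neg_mem_twinned p q (single_mem_chainPolytope q l), by
        simp [map_neg, pairFunctional_single, hl, hl']⟩
    simpa using Submodule.neg_mem _ this
  refine span_eq_top_of_single fun i => ?_
  by_cases hi1 : i ∈ z.1
  · exact h1 i hi1
  by_cases hi2 : i ∈ z.2
  · exact h2 i hi2
  rcases hext i (mem_univ _) (mem_univ _) hi1 hi2 with ⟨k, hk, hik⟩ | ⟨l, hl, hil⟩
  · have hne : i ≠ k := fun e => hi1 (e ▸ hk)
    have : Pi.single i 1 + Pi.single k 1 ∈ Submodule.span ℝ (pairFace p q z.1 z.2) :=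
      Submodule.subset_span
        ⟨left_subset_twinned p q (single_add_single_mem_chainPolytope p hne hik), by
          simp [map_add, pairFunctional_single, hk, hKL k hk, hi1, hi2]⟩
    simpa using Submodule.sub_mem _ this (h1 k hk)
  · have hne : i ≠ l := fun e => hi2 (e ▸ hl)
    have hl' : l ∉ z.1 := fun h => hKL l h hl
    have : -(Pi.single i 1 + Pi.single l 1) ∈ Submodule.span ℝ (pairFace p q z.1 z.2) :=
      Submodule.subset_span
        ⟨neg_mem_twinned p q (single_add_single_mem_chainPolytope q hne hil), by
          rw [map_neg, map_add]
          simp [pairFunctional_single, hl, hl', hi1, hi2]⟩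
    have := Submodule.sub_mem _ (Submodule.neg_mem _ this) (h2 l hl)
    simpa using this

theorem eq_of_pairFunctional_eq {K L K' L' : Finset (Fin d)} (hKL : ∀ i ∈ K, i ∉ L)
    (hKL' : ∀ i ∈ K', i ∉ L') (h : pairFunctional K L = pairFunctional K' L') :
    K = K' ∧ L = L' := by
  have key : ∀ i, ((if i ∈ K then 1 else 0) - if i ∈ L then 1 else 0 : ℝ) =
      (if i ∈ K' then 1 else 0) - if i ∈ L' then 1 else 0 := fun i => by
    rw [← pairFunctional_single, ← pairFunctional_single, h]
  constructor <;> ext i <;> have h1 := key i <;> have h2 := hKL i <;> have h3 := hKL' i <;>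
    split_ifs at h1 <;> first | (exfalso; linarith) | tauto

/-- A functional equal to 1 on a spanning set is determined by it, and its coefficients 1 and -1
recover K and L. -/
theorem injOn_pairFace : Set.InjOn (fun z : Finset (Fin d) × Finset (Fin d) =>
    pairFace p q z.1 z.2) (cliquePairs (indexGraph p) (indexGraph q) univ univ) := by
  intro z hz w hw h
  have heq : pairFunctional z.1 z.2 = pairFunctional w.1 w.2 := by
    refine LinearMap.ext_on (span_pairFace hz) fun x hx => ?_
    rw [hx.2]
    have hzw : pairFace p q z.1 z.2 = pairFace p q w.1 w.2 := h
    rw [hzw] at hx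
    rw [hx.2]
  have h1 := eq_of_pairFunctional_eq (mem_cliquePairs.1 hz).2.2.2.2.1
    (mem_cliquePairs.1 hw).2.2.2.2.1 heq
  exact Prod.ext h1.1 h1.2

theorem isFacet_pairFace {z : Finset (Fin d) × Finset (Fin d)}
    (hz : z ∈ cliquePairs (indexGraph p) (indexGraph q) univ univ) :
    IsFacet (twinnedChainPolytope p q) (pairFace p q z.1 z.2) := by
  refine ⟨?_, ?_⟩
  · rintro ⟨x₀, hx₀⟩
    refine ⟨LinearMap.toContinuousLinearMap (pairFunctional z.1 z.2), Set.ext fun x => ?_⟩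
    simp only [LinearMap.coe_toContinuousLinearMap']
    constructor
    · rintro ⟨hx, hx1⟩
      exact ⟨hx, fun y hy => hx1 ▸ pairFunctional_le_one hz hy⟩
    · rintro ⟨hx, hx1⟩
      exact ⟨hx, le_antisymm (pairFunctional_le_one hz hx) (hx₀.2 ▸ hx1 x₀ hx₀.1)⟩
  · rw [convDim_of_span_eq_top (pairFunctional z.1 z.2) (fun x hx => hx.2) (span_pairFace hz),
      convDim_twinnedChainPolytope]

/-- A set on which no facet inequality is tight at all its points can be scaled outwards. -/
theorem exists_pairFunctional_eq_one {F : Set (Fin d → ℝ)} (l : (Fin d → ℝ) →ₗ[ℝ] ℝ) {m : ℝ}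
    (hm : 0 < m) (hF : F ⊆ twinnedChainPolytope p q) (hlF : ∀ x ∈ F, l x = m)
    (hl : ∀ x ∈ twinnedChainPolytope p q, l x ≤ m) :
    ∃ K L : Finset (Fin d), (∀ i ∈ K, ∀ j ∈ K, i ≠ j → (indexGraph p).Adj i j) ∧
      (∀ i ∈ L, ∀ j ∈ L, i ≠ j → (indexGraph q).Adj i j) ∧ (∀ i ∈ K, i ∉ L) ∧
      ∀ x ∈ F, pairFunctional K L x = 1 := by
  classical
  by_contra! hcon
  set C : Finset (Finset (Fin d) × Finset (Fin d)) := univ.filter fun z =>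
    (∀ i ∈ z.1, ∀ j ∈ z.1, i ≠ j → (indexGraph p).Adj i j) ∧
      (∀ i ∈ z.2, ∀ j ∈ z.2, i ≠ j → (indexGraph q).Adj i j) ∧ (∀ i ∈ z.1, i ∉ z.2) with hC
  have hle : ∀ z ∈ C, ∀ x ∈ twinnedChainPolytope p q, pairFunctional z.1 z.2 x ≤ 1 := by
    intro z hz x hx
    obtain ⟨h1, h2, h3⟩ := (mem_filter.1 hz).2
    exact (mem_twinnedChainPolytope_iff p q).1 hx _ _ h1 h2 h3
  have hex : ∀ z : Finset (Fin d) × Finset (Fin d), ∃ x, z ∈ C →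
      x ∈ F ∧ pairFunctional z.1 z.2 x < 1 := by
    intro z
    by_cases hz : z ∈ C
    · obtain ⟨h1, h2, h3⟩ := (mem_filter.1 hz).2
      obtain ⟨x, hx, hne⟩ := hcon z.1 z.2 h1 h2 h3
      exact ⟨x, fun _ => ⟨hx, lt_of_le_of_ne (hle z hz x (hF hx)) hne⟩⟩
    · exact ⟨0, fun h => absurd h hz⟩
  choose f hf using hex
  -- Up to scaling, a point at which every inequality is strict, since each has a witness in F.
  set y := ∑ z ∈ C, f z with hy
  have h0C : (∅, ∅) ∈ C := by simp [hC]
  have hCpos : (0 : ℝ) < #C := by exact_mod_cast card_pos.2 ⟨_, h0C⟩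
  have hylt : ∀ z ∈ C, pairFunctional z.1 z.2 y < #C := by
    intro z hz
    rw [hy, map_sum, ← mul_one (#C : ℝ), ← nsmul_eq_mul, ← sum_const]
    exact sum_lt_sum (fun w hw => hle z hz _ (hF (hf w hw).1)) ⟨z, hz, (hf z hz).2⟩
  obtain ⟨z₀, hz₀, hmax⟩ := exists_max_image C (fun z => pairFunctional z.1 z.2 y) ⟨_, h0C⟩
  set M := pairFunctional z₀.1 z₀.2 y with hM
  -- The second entry only keeps t positive; t < #C makes `t⁻¹ • y` violate l ≤ m.
  set t := max M (#C / 2) with ht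
  have htpos : 0 < t := lt_max_of_lt_right (by positivity)
  have htlt : t < #C := max_lt (hylt z₀ hz₀) (by linarith)
  have hmem : t⁻¹ • y ∈ twinnedChainPolytope p q := by
    refine (mem_twinnedChainPolytope_iff p q).2 fun K L hK hL hKL => ?_
    have h1 := hmax (K, L) (by simp only [hC, mem_filter, mem_univ, true_and]; exact ⟨hK, hL, hKL⟩)
    rw [map_smul, smul_eq_mul, inv_mul_le_iff₀ htpos, mul_one]
    exact h1.trans (le_max_left _ _)
  have h1 := hl _ hmem
  have h2 : l y = #C * m := by
    rw [hy, map_sum, sum_congr rfl fun z hz => hlF _ (hf z hz).1, sum_const, nsmul_eq_mul]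
  rw [map_smul, smul_eq_mul, h2, inv_mul_le_iff₀ htpos] at h1
  nlinarith

/-- A nonempty facet lies off the origin's level of l, because ±e_i are in the polytope; hence it
spans. Some clique inequality is tight on it, and spanning makes l a positive multiple of that
functional. -/
theorem exists_of_isFacet {F : Set (Fin d → ℝ)} (hF : IsFacet (twinnedChainPolytope p q) F) :
    ∃ z ∈ cliquePairs (indexGraph p) (indexGraph q) univ univ, pairFace p q z.1 z.2 = F := by
  classical
  obtain ⟨hexp, hdim⟩ := hF
  rw [convDim_twinnedChainPolytope] at hdim
  rcases F.eq_empty_or_nonempty with rfl | hne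
  · have hd : d = 0 := by
      rw [convDim, if_pos rfl] at hdim
      omega
    subst hd
    refine ⟨(∅, ∅), by simp [mem_cliquePairs], ?_⟩
    simp [pairFace, pairFunctional]
  obtain ⟨l, hl⟩ := hexp hne
  have hdim' : (Module.finrank ℝ (vectorSpan ℝ F) : ℤ) = d - 1 := by
    rw [← hdim, convDim, if_neg hne.ne_empty]
  obtain ⟨x₀, hx₀⟩ := hne
  have hFsub : F ⊆ twinnedChainPolytope p q := fun x hx => by
    rw [hl] at hx
    exact hx.1
  have hle : ∀ x ∈ twinnedChainPolytope p q, l x ≤ l x₀ := by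
    rw [hl] at hx₀
    exact hx₀.2
  have hlF : ∀ x ∈ F, l x = l x₀ := fun x hx => by
    refine le_antisymm (hle x (hFsub hx)) ?_
    rw [hl] at hx
    exact hx.2 x₀ (hFsub hx₀)
  have h0 := hle 0 (left_subset_twinned p q (zero_mem_chainPolytope p))
  rw [map_zero] at h0
  have hpos : 0 < l x₀ := by
    refine lt_of_le_of_ne h0 fun heq => ?_
    have hzero : ∀ i, l (Pi.single i 1) = 0 := fun i => by
      have h1 := hle _ (left_subset_twinned p q (single_mem_chainPolytope p i))
      have h2 := hle _ (neg_mem_twinned p q (single_mem_chainPolytope q i))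
      rw [map_neg] at h2
      linarith
    have hl0 : (l : (Fin d → ℝ) →ₗ[ℝ] ℝ) = 0 := by
      refine (Pi.basisFun ℝ (Fin d)).ext fun i => ?_
      simpa using hzero i
    have hl0' : ∀ x, l x = 0 := fun x => LinearMap.congr_fun hl0 x
    have : F = twinnedChainPolytope p q := by
      rw [hl]
      ext x
      simp [hl0']
    rw [this, convDim_twinnedChainPolytope] at hdim
    omega
  have hspan : Submodule.span ℝ F = ⊤ := by
    have h1 : vectorSpan ℝ F ≤ LinearMap.ker (l : (Fin d → ℝ) →ₗ[ℝ] ℝ) := by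
      rw [vectorSpan_def, Submodule.span_le]
      rintro _ ⟨a, ha, b, hb, rfl⟩
      simp [hlF a ha, hlF b hb]
    have h2 : vectorSpan ℝ F ≤ Submodule.span ℝ F := by
      rw [vectorSpan_def, Submodule.span_le]
      rintro _ ⟨a, ha, b, hb, rfl⟩
      exact Submodule.sub_mem _ (Submodule.subset_span ha) (Submodule.subset_span hb)
    have h3 : vectorSpan ℝ F < Submodule.span ℝ F := by
      refine lt_of_le_of_ne h2 fun heq => ?_
      have h4 : x₀ ∈ vectorSpan ℝ F := heq ▸ Submodule.subset_span hx₀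
      have h5 := h1 h4
      rw [LinearMap.mem_ker] at h5
      exact hpos.ne' h5
    have h4 := Submodule.finrank_lt_finrank_of_lt h3
    refine Submodule.eq_top_of_finrank_eq (le_antisymm (Submodule.finrank_le _) ?_)
    rw [Module.finrank_fin_fun]
    omega
  obtain ⟨K, L, hK, hL, hKL, hone⟩ := exists_pairFunctional_eq_one
    (l : (Fin d → ℝ) →ₗ[ℝ] ℝ) hpos hFsub hlF hle
  have hlf : (l : (Fin d → ℝ) →ₗ[ℝ] ℝ) = l x₀ • pairFunctional K L :=
    LinearMap.ext_on hspan fun x hx => by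
      rw [LinearMap.smul_apply, hone x hx, smul_eq_mul, mul_one]
      exact hlF x hx
  have hlf' : ∀ x, l x = l x₀ * pairFunctional K L x := fun x => LinearMap.congr_fun hlf x
  refine ⟨(K, L), mem_cliquePairs.2 ⟨subset_univ _, subset_univ _, hK, hL, hKL, ?_⟩, ?_⟩
  · intro i _ _ hiK hiL
    by_contra! hcon
    obtain ⟨hcK, hcL⟩ := hcon
    have hins : ∀ (G : SimpleGraph (Fin d)) (K : Finset (Fin d)),
        (∀ a ∈ K, ∀ b ∈ K, a ≠ b → G.Adj a b) → (∀ k ∈ K, G.Adj i k) →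
        ∀ a ∈ insert i K, ∀ b ∈ insert i K, a ≠ b → G.Adj a b := by
      intro G K hK hi a ha b hb hab
      rcases mem_insert.1 ha with ha | ha <;> rcases mem_insert.1 hb with hb | hb
      · exact absurd (ha.trans hb.symm) hab
      · exact ha ▸ hi b hb
      · exact hb ▸ (hi a ha).symm
      · exact hK a ha b hb hab
    -- Adding i to K gives x_i ≤ 0 and adding it to L gives -x_i ≤ 0, which contradicts that F
    -- spans.
    have hxi : ∀ x ∈ F, x i = 0 := by
      intro x hx
      have h1 := (mem_twinnedChainPolytope_iff p q).1 (hFsub hx) (insert i K) L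
        (hins _ K hK hcK) hL (by
          intro a ha
          rcases mem_insert.1 ha with ha | ha
          · exact ha ▸ hiL
          · exact hKL a ha)
      have h2 := (mem_twinnedChainPolytope_iff p q).1 (hFsub hx) K (insert i L)
        hK (hins _ L hL hcL) (by
          intro a ha ha'
          rcases mem_insert.1 ha' with h | h
          · exact hiK (h ▸ ha)
          · exact hKL a ha h)
      have h3 := hone x hx
      rw [pairFunctional_apply] at h1 h2 h3
      rw [sum_insert hiK] at h1
      rw [sum_insert hiL] at h2
      linarith
    have hproj : (LinearMap.proj i : (Fin d → ℝ) →ₗ[ℝ] ℝ) = 0 :=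
      LinearMap.ext_on hspan fun x hx => by simpa using hxi x hx
    have := LinearMap.congr_fun hproj (Pi.single i 1)
    simp at this
  · ext x
    constructor
    · rintro ⟨hx, hx1⟩
      rw [hl]
      exact ⟨hx, fun y hy => by rw [hlf' x, hx1, mul_one]; exact hle y hy⟩
    · intro hx
      exact ⟨hFsub hx, hone x hx⟩

theorem facetSet_twinnedChainPolytope (p : Fin d ≃ P) (q : Fin d ≃ Q) :
    facetSet (twinnedChainPolytope p q) = (fun z : Finset (Fin d) × Finset (Fin d) =>
      pairFace p q z.1 z.2) '' (cliquePairs (indexGraph p) (indexGraph q) univ univ) := by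
  ext F
  constructor
  · intro hF
    obtain ⟨z, hz, rfl⟩ := exists_of_isFacet hF
    exact ⟨z, hz, rfl⟩
  · rintro ⟨z, hz, rfl⟩
    exact isFacet_pairFace hz

theorem numFacets_twinnedChainPolytope (p : Fin d ≃ P) (q : Fin d ≃ Q) :
    numFacets (twinnedChainPolytope p q) =
      #(cliquePairs (indexGraph p) (indexGraph q) univ univ) := by
  rw [numFacets, facetSet_twinnedChainPolytope, injOn_pairFace.ncard_image,
    Set.ncard_coe_finset]

end

/-! ### The extremal posets -/

/-- The clique pairs of a complete multipartite graph with `k` parts of size two. -/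
theorem six_pow_le_card_cliquePairs {α : Type*} [Fintype α] [DecidableEq α] {G : SimpleGraph α}
    {k : ℕ} (e : α ≃ Fin k × Fin 2) (hG : ∀ i j, G.Adj i j ↔ (e i).1 ≠ (e j).1) :
    6 ^ k ≤ #(cliquePairs G G univ univ) := by
  -- Signs 1, -1, 0 mean membership in K, in L, in neither. Two elements of one part are never in
  -- the same state: equal nonzero signs break the clique condition, and two zeros leave both
  -- unblocked.
  have hcard : Fintype.card {g : Fin 2 → SignType // g 0 ≠ g 1} = 6 := by decide
  have hc : #(univ : Finset (Fin k → {g : Fin 2 → SignType // g 0 ≠ g 1})) = 6 ^ k := by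
    simp [hcard]
  have hne : ∀ g : {g : Fin 2 → SignType // g 0 ≠ g 1}, ∀ a b : Fin 2, a ≠ b →
      g.1 a ≠ g.1 b := by
    intro g a b hab
    have := g.2
    fin_cases a <;> fin_cases b <;> simp_all [eq_comm]
  rw [← hc]
  refine card_le_card_of_injOn (fun f => (univ.filter fun i => (f (e i).1).1 (e i).2 = 1,
    univ.filter fun i => (f (e i).1).1 (e i).2 = -1)) ?_ ?_
  · intro f _
    have hcl : ∀ s : SignType, ∀ i ∈ univ.filter fun i => (f (e i).1).1 (e i).2 = s,
        ∀ j ∈ univ.filter fun i => (f (e i).1).1 (e i).2 = s, i ≠ j → G.Adj i j := by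
      intro s i hi j hj hij
      rw [mem_filter] at hi hj
      rw [hG]
      intro heq
      have h2 : (e i).2 ≠ (e j).2 := fun h2 => hij (e.injective (Prod.ext heq h2))
      refine hne (f (e i).1) _ _ h2 ?_
      rw [hi.2, heq, hj.2]
    rw [mem_coe, mem_cliquePairs]
    refine ⟨subset_univ _, subset_univ _, hcl 1, hcl (-1), ?_, ?_⟩
    · intro i hi hi'
      rw [mem_filter] at hi hi'
      have := hi.2.symm.trans hi'.2
      revert this
      decide
    · intro i _ _ hi1 hi2
      simp only [mem_filter, mem_univ, true_and] at hi1 hi2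
      have h0 : (f (e i).1).1 (e i).2 = 0 := by
        revert hi1 hi2
        generalize (f (e i).1).1 (e i).2 = s
        revert s
        decide
      set j := e.symm ((e i).1, (e i).2 + 1) with hj
      have hej : e j = ((e i).1, (e i).2 + 1) := by simp [hj]
      have hadj : ¬ G.Adj i j := by simp [hG, hej]
      have hne0 : (f (e j).1).1 (e j).2 ≠ 0 := by
        rw [hej, ← h0]
        exact hne _ _ _ ((by decide : ∀ a : Fin 2, a + 1 ≠ a) _)
      have hpm : (f (e j).1).1 (e j).2 = 1 ∨ (f (e j).1).1 (e j).2 = -1 := by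
        revert hne0
        generalize (f (e j).1).1 (e j).2 = s
        revert s
        decide
      rcases hpm with h | h
      · exact Or.inl ⟨j, by simp [h], hadj⟩
      · exact Or.inr ⟨j, by simp [h], hadj⟩
  · intro f _ g _ hfg
    rw [Prod.mk.injEq] at hfg
    funext c
    refine Subtype.ext (funext fun b => ?_)
    have h1 := Finset.ext_iff.1 hfg.1 (e.symm (c, b))
    have h2 := Finset.ext_iff.1 hfg.2 (e.symm (c, b))
    simp only [mem_filter, mem_univ, true_and, Equiv.apply_symm_apply] at h1 h2
    revert h1 h2
    generalize (f c).1 b = s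
    generalize (g c).1 b = t
    revert s t
    decide

theorem ordinalSumI2_le_iff {k : ℕ} {a b : ordinalSumI2 k} :
    a ≤ b ↔ (ofLex a).1 < (ofLex b).1 ∨ a = b := by
  obtain ⟨a, rfl⟩ := toLex.surjective a
  obtain ⟨b, rfl⟩ := toLex.surjective b
  obtain ⟨a1, a2⟩ := a
  obtain ⟨b1, b2⟩ := b
  rw [Sigma.Lex.le_def]
  constructor
  · rintro (h | ⟨h, h'⟩)
    · exact Or.inl h
    · right
      change a1 = b1 at h
      subst h
      change a2 = b2 at h'
      rw [h']
  · rintro (h | h)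
    · exact Or.inl h
    · rw [toLex_inj, Sigma.mk.injEq] at h
      obtain ⟨rfl, h⟩ := h
      exact Or.inr ⟨rfl, eq_of_heq h⟩

theorem exists_equiv_of_orderIso {d k : ℕ} {P : Type*} [PartialOrder P] (p : Fin d ≃ P)
    (o : P ≃o ordinalSumI2 k) : ∃ e : Fin d ≃ Fin k × Fin 2, ∀ i j,
      (indexGraph p).Adj i j ↔ (e i).1 ≠ (e j).1 := by
  let u : ordinalSumI2 k ≃ Fin k × Fin 2 := ofLex.trans (Equiv.sigmaEquivProd (Fin k) (Fin 2))
  have hu : ∀ a, (u a).1 = (ofLex a).1 := fun a => rfl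
  refine ⟨(p.trans o.toEquiv).trans u, fun i j => ?_⟩
  rw [indexGraph_adj, ← o.le_iff_le, ← o.le_iff_le (x := p j), ordinalSumI2_le_iff,
    ordinalSumI2_le_iff]
  simp only [Equiv.trans_apply, hu, RelIso.coe_fn_toEquiv, o.injective.eq_iff,
    p.injective.eq_iff]
  constructor
  · rintro ⟨hij, (h | h) | (h | h)⟩
    · exact h.ne
    · exact absurd h hij
    · exact h.ne'
    · exact absurd h.symm hij
  · intro h
    refine ⟨fun e => h (e ▸ rfl), ?_⟩
    rcases lt_or_gt_of_ne h with h | h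
    · exact Or.inl (Or.inl h)
    · exact Or.inr (Or.inl h)

/-- A poset in which every element is incomparable to exactly one other element is an ordinal sum
of two-element antichains. -/
theorem nonempty_orderIso_ordinalSumI2 {d k : ℕ} {P : Type*} [PartialOrder P] (p : Fin d ≃ P)
    (hd : d = 2 * k) (h : ∀ i, ∃ j, nonNbrs (indexGraph p) univ i = {j}) :
    Nonempty (P ≃o ordinalSumI2 k) := by
  classical
  choose σ hσ using h
  have mem_iff : ∀ i j, j = σ i ↔ j ≠ i ∧ ¬ (indexGraph p).Adj i j := fun i j => by
    rw [← mem_singleton, ← hσ, mem_nonNbrs]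
    simp
  have hσne : ∀ i, σ i ≠ i := fun i => ((mem_iff i _).1 rfl).1
  have hσadj : ∀ i, ¬ (indexGraph p).Adj i (σ i) := fun i => ((mem_iff i _).1 rfl).2
  have hσσ : ∀ i, σ (σ i) = i := fun i =>
    ((mem_iff (σ i) i).2 ⟨(hσne i).symm, fun h => hσadj i h.symm⟩).symm
  have inc : ∀ i, ¬ p i ≤ p (σ i) ∧ ¬ p (σ i) ≤ p i := fun i => by
    have := hσadj i
    rw [indexGraph_adj] at this
    push Not at this
    have := this (hσne i).symm
    exact ⟨this.1, this.2⟩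
  have tri : ∀ i j, i = j ∨ i = σ j ∨ p i < p j ∨ p j < p i := fun i j => by
    by_cases hij : i = j
    · exact Or.inl hij
    by_cases hadj : (indexGraph p).Adj j i
    · have hp : p i ≠ p j := fun e => hij (p.injective e)
      rcases (indexGraph_adj.1 hadj).2 with h | h
      · exact Or.inr (Or.inr (Or.inr (lt_of_le_of_ne h hp.symm)))
      · exact Or.inr (Or.inr (Or.inl (lt_of_le_of_ne h hp)))
    · exact Or.inr (Or.inl ((mem_iff j i).2 ⟨hij, hadj⟩))
  have lt_σ : ∀ i j, p i < p j → p i < p (σ j) := fun i j hij => by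
    rcases tri i (σ j) with h | h | h | h
    · exact absurd (h ▸ hij.le) (inc j).2
    · rw [hσσ] at h
      exact absurd (h ▸ hij) (lt_irrefl _)
    · exact h
    · exact absurd (h.trans hij).le (inc j).2
  -- By `lt_σ` two partners have the same elements below them, so r is constant on partner pairs and
  -- separates different pairs. Its k values, renumbered in order, index the summands.
  set r : Fin d → ℕ := fun i => #(univ.filter fun j => p j < p i) with hr
  have r_lt : ∀ i j, p i < p j → r i < r j := fun i j hij => by
    refine card_lt_card (ssubset_iff_of_subset ?_ |>.2 ⟨i, by simpa using hij, by simp⟩)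
    intro a ha
    simp only [mem_filter, mem_univ, true_and] at ha ⊢
    exact ha.trans hij
  have r_σ : ∀ i, r (σ i) = r i := fun i => by
    simp only [hr]
    congr 1
    ext j
    simp only [mem_filter, mem_univ, true_and]
    exact ⟨fun h => by simpa [hσσ] using lt_σ _ _ h, lt_σ _ _⟩
  have r_eq : ∀ i j, r i = r j ↔ i = j ∨ i = σ j := fun i j => by
    constructor
    · intro hij
      rcases tri i j with h | h | h | h
      · exact Or.inl h
      · exact Or.inr h
      · exact absurd hij (r_lt _ _ h).ne
      · exact absurd hij (r_lt _ _ h).ne'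
    · rintro (rfl | rfl)
      · rfl
      · exact r_σ j
  set R : Finset ℕ := univ.image r with hR
  have hRcard : #R = k := by
    have h1 := card_eq_sum_card_image r univ
    rw [sum_congr rfl (g := fun _ => 2), sum_const, ← hR] at h1
    · simp at h1
      omega
    · intro b hb
      obtain ⟨i, -, rfl⟩ := mem_image.1 hb
      rw [show (univ.filter fun a => r a = r i) = {i, σ i} by
        ext a
        simp [r_eq], card_pair (hσne i).symm]
  have hmem : ∀ i, r i ∈ R := fun i => mem_image_of_mem r (mem_univ i)
  set c : Fin d → Fin k := fun i => (R.orderIsoOfFin hRcard).symm ⟨r i, hmem i⟩ with hc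
  have c_lt : ∀ i j, c i < c j ↔ r i < r j := fun i j => by
    simp [hc, OrderIso.lt_iff_lt]
  have c_eq : ∀ i j, c i = c j ↔ r i = r j := fun i j => by
    simp [hc]
  obtain ⟨b, b_σ⟩ : ∃ b : Fin d → AntichainPoset 2, ∀ i, b (σ i) ≠ b i := by
    have : ∃ b : Fin d → Fin 2, ∀ i, b (σ i) ≠ b i := by
      -- Any labelling that separates partners would do; the order of indices supplies one.
      refine ⟨fun i => if i < σ i then 0 else 1, fun i => ?_⟩
      simp only [hσσ]
      rcases lt_or_gt_of_ne (hσne i) with h | h <;> simp [h, h.not_gt]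
    exact this
  let f : P → ordinalSumI2 k := fun x => toLex ⟨c (p.symm x), b (p.symm x)⟩
  have hf : ∀ x y, f x ≤ f y ↔ x ≤ y := by
    intro x y
    obtain ⟨i, rfl⟩ := p.surjective x
    obtain ⟨j, rfl⟩ := p.surjective y
    rw [ordinalSumI2_le_iff]
    simp only [f, Equiv.symm_apply_apply, ofLex_toLex, toLex_inj, Sigma.mk.injEq, heq_eq_eq]
    rw [c_lt, c_eq, r_eq]
    constructor
    · rintro (hlt | ⟨rfl | rfl, hbb⟩)
      · rcases tri i j with h | h | h | h
        · rw [h]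
        · rw [h, r_σ] at hlt
          exact absurd hlt (lt_irrefl _)
        · exact h.le
        · exact absurd hlt (r_lt _ _ h).not_gt
      · exact le_rfl
      · exact absurd hbb (b_σ j)
    · intro hle
      rcases hle.lt_or_eq with h | h
      · exact Or.inl (r_lt _ _ h)
      · rw [p.injective h]
        simp
  have hsurj : Function.Surjective f := by
    intro y
    obtain ⟨⟨c₀, b₀⟩, rfl⟩ := toLex.surjective y
    obtain ⟨i, -, hi⟩ := mem_image.1 ((R.orderIsoOfFin hRcard) c₀).2
    have hci : c i = c₀ := by
      simp only [hc]
      rw [OrderIso.symm_apply_eq]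
      exact Subtype.ext hi
    have key : ∀ a b c : Fin 2, a ≠ b → c = a ∨ c = b := by decide
    rcases key (b (σ i)) (b i) b₀ (b_σ i) with h | h
    · refine ⟨p (σ i), ?_⟩
      simp only [f, Equiv.symm_apply_apply]
      rw [(c_eq (σ i) i).2 (r_σ i), hci]
      exact congrArg (fun b => toLex (⟨c₀, b⟩ : Σ _ : Fin k, AntichainPoset 2)) h.symm
    · refine ⟨p i, ?_⟩
      simp only [f, Equiv.symm_apply_apply]
      rw [hci]
      exact congrArg (fun b => toLex (⟨c₀, b⟩ : Σ _ : Fin k, AntichainPoset 2)) h.symm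
  exact ⟨RelIso.ofSurjective (OrderEmbedding.ofMapLEIff f hf) hsurj⟩

/-! ### Real powers and the final statement -/

theorem rpow_half_of_even {d : ℕ} (h : Even d) : (6 : ℝ) ^ ((d : ℝ) / 2) = pairBound d := by
  obtain ⟨m, rfl⟩ := h
  rw [← two_mul, pairBound_two_mul, ← Real.rpow_natCast]
  congr 1
  push_cast
  ring

theorem rpow_half_of_odd {d : ℕ} (h : Odd d) :
    14 * (6 : ℝ) ^ (((d : ℝ) - 3) / 2) = pairBound d ∧
      7 * √6 / 18 * (6 : ℝ) ^ ((d : ℝ) / 2) = pairBound d ∧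
      pairBound d ≤ (6 : ℝ) ^ ((d : ℝ) / 2) := by
  obtain ⟨m, rfl⟩ := h
  have hs : √6 * √6 = (6 : ℝ) := Real.mul_self_sqrt (by norm_num)
  -- As 49/9 ≤ 6, the odd bound is below `6 ^ (d / 2)`.
  have hs0 : (7 / 3 : ℝ) ≤ √6 := Real.le_sqrt_of_sq_le (by norm_num)
  have h1 : (6 : ℝ) ^ (((2 * m + 1 : ℕ) : ℝ) / 2) = 6 ^ m * √6 := by
    rw [show ((2 * m + 1 : ℕ) : ℝ) / 2 = m + 1 / 2 by push_cast; ring,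
      Real.rpow_add (by norm_num), Real.rpow_natCast, Real.sqrt_eq_rpow]
  have h2 : (6 : ℝ) ^ ((((2 * m + 1 : ℕ) : ℝ) - 3) / 2) = 6 ^ m / 6 := by
    rw [show (((2 * m + 1 : ℕ) : ℝ) - 3) / 2 = m - 1 by push_cast; ring,
      Real.rpow_sub (by norm_num), Real.rpow_natCast, Real.rpow_one]
  have hpos : (0 : ℝ) < 6 ^ m := by positivity
  rw [h1, h2, pairBound_two_mul_add_one]
  refine ⟨by ring, ?_, by nlinarith⟩
  calc 7 * √6 / 18 * (6 ^ m * √6) = 7 / 18 * 6 ^ m * (√6 * √6) := by ring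
    _ = _ := by rw [hs]; ring

theorem theorem1p2 {P Q : Type*} [PartialOrder P] [PartialOrder Q]
    (d : ℕ) (p : Fin d ≃ P) (q : Fin d ≃ Q) :
    (facetSet (twinnedChainPolytope p q)).Finite ∧
    (Even d →
      (numFacets (twinnedChainPolytope p q) : ℝ) ≤ (6 : ℝ) ^ ((d : ℝ) / 2)) ∧
    (Odd d →
      (numFacets (twinnedChainPolytope p q) : ℝ) ≤ 14 * (6 : ℝ) ^ (((d : ℝ) - 3) / 2) ∧
      14 * (6 : ℝ) ^ (((d : ℝ) - 3) / 2) = 7 * √6 / 18 * (6 : ℝ) ^ ((d : ℝ) / 2)) ∧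
    (numFacets (twinnedChainPolytope p q) : ℝ) ≤ (6 : ℝ) ^ ((d : ℝ) / 2) ∧
    (Even d →
      ((numFacets (twinnedChainPolytope p q) : ℝ) = (6 : ℝ) ^ ((d : ℝ) / 2) ↔
        Nonempty (P ≃o ordinalSumI2 (d / 2)) ∧
        Nonempty (Q ≃o ordinalSumI2 (d / 2)) ∧
        ∃ φ : comparabilityGraph P ≃g comparabilityGraph Q, ∀ i : Fin d, φ (p i) = q i)) := by
  have hle : (numFacets (twinnedChainPolytope p q) : ℝ) ≤ pairBound d := by
    rw [numFacets_twinnedChainPolytope]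
    simpa using (branchBound (indexGraph p) (indexGraph q) univ).card_le
  refine ⟨?_, ?_, ?_, ?_, ?_⟩
  · rw [facetSet_twinnedChainPolytope]
    exact (Finset.finite_toSet _).image _
  · intro h
    rwa [rpow_half_of_even h]
  · intro h
    obtain ⟨h1, h2, -⟩ := rpow_half_of_odd h
    rw [h1, h2]
    exact ⟨hle, rfl⟩
  · rcases Nat.even_or_odd d with h | h
    · rwa [rpow_half_of_even h]
    · exact hle.trans (rpow_half_of_odd h).2.2
  · intro heven
    have hd : d = 2 * (d / 2) := by
      have := Nat.even_iff.1 heven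
      omega
    rw [rpow_half_of_even heven]
    constructor
    · intro heq
      have hm : ∀ i, ∃ j, nonNbrs (indexGraph p) univ i = {j} ∧
          nonNbrs (indexGraph q) univ i = {j} := fun i =>
        (branchBound (indexGraph p) (indexGraph q) univ).matching_of_even (by simpa using heven)
          (by rw [← numFacets_twinnedChainPolytope, heq]; simp) (mem_univ i)
      -- The two graphs have the same non-neighbours everywhere, so they agree on the index set;
      -- this is what makes p_i ↦ q_i a graph isomorphism.
      have hadj : ∀ i j, (indexGraph q).Adj i j ↔ (indexGraph p).Adj i j := by
        intro i j
        by_cases hij : j = i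
        · simp [hij]
        · obtain ⟨u, h1, h2⟩ := hm i
          have := Finset.ext_iff.1 (h1.trans h2.symm) j
          simp only [mem_nonNbrs, mem_univ, ne_eq, hij, not_false_eq_true, true_and] at this
          tauto
      refine ⟨nonempty_orderIso_ordinalSumI2 p hd fun i => (hm i).imp fun _ => And.left,
        nonempty_orderIso_ordinalSumI2 q hd fun i => (hm i).imp fun _ => And.right,
        ⟨p.symm.trans q, ?_⟩, fun i => by
          change q (p.symm (p i)) = q i
          rw [Equiv.symm_apply_apply]⟩
      intro a b
      obtain ⟨i, rfl⟩ := p.surjective a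
      obtain ⟨j, rfl⟩ := p.surjective b
      simpa [indexGraph] using hadj i j
    · rintro ⟨⟨o⟩, -, φ, hφ⟩
      have hGH : indexGraph q = indexGraph p := by
        ext i j
        simp only [indexGraph, SimpleGraph.comap_adj]
        rw [← hφ i, ← hφ j]
        exact φ.map_adj_iff
      obtain ⟨e, he⟩ := exists_equiv_of_orderIso p o
      refine le_antisymm hle ?_
      rw [numFacets_twinnedChainPolytope, hGH]
      have := six_pow_le_card_cliquePairs e he
      conv_lhs => rw [hd, pairBound_two_mul]
      exact_mod_cast this
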